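/- Let $\mathcal G$ be a Hausdorff topological groupoid (a small category in which every morphism is invertible, identified with its set of arrows, with a Hausdorff topology for which inversion and the multiplication of composable arrows are continuous). Let $\mathcal G^{(0)}=\{\gamma\gamma^{-1}:\gamma\in\mathcal G\}$ be its space of units, and $s(\gamma)=\gamma^{-1}\gamma$, $r(\gamma)=\gamma\gamma^{-1}$. A compact open bisection is a compact open set $B\subseteq\mathcal G$ on which $s$ and $r$ restrict to homeomorphisms onto open subsets of $\mathcal G^{(0)}$. Assume the following. 1. $\mathcal G^{(0)}$ is a Cantor space, and $\mathcal G$ is ample: the compact open bisections form a basis of the topology of $\mathcal G$. 2. $\mathcal G$ is expansive: there are a compact set $K\subseteq\mathcal G$ with $\mathcal G=\bigcup_{n\ge 1}(K\cup K^{-1})^n$ and a finite collection $\mathcal B$ of compact open bisections covering $K$ such that the collection $\bigcup_{n\ge1}(\mathcal B\cup\mathcal B^{-1})^n$ of all sets $B_1B_2\cdots B_n$ with $n\ge 1$ and each $B_i$ in $\mathcal B\cup\mathcal B^{-1}$ is a basis of the topology of $\mathcal G$. 3. $\mathcal G$ is essentially principal: the set of $x\in\mathcal G^{(0)}$ such that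 $x$ is the only $\gamma\in\mathcal G$ with $s(\gamma)=r(\gamma)=x$ is dense in $\mathcal G^{(0)}$. 4. $\mathcal G$ is minimal: for every $x\in\mathcal G^{(0)}$ the orbit $\{r(\gamma):s(\gamma)=x\}$ is dense in $\mathcal G^{(0)}$. 5. $\mathcal G$ is purely infinite: for every compact open $X\subseteq\mathcal G^{(0)}$ there are compact open bisections $B,B'$ with $s(B)=s(B')=X$ and with $r(B)$, $r(B')$ disjoint and contained in $X$. Let $\mathsf F(\mathcal G)\subseteq\mathrm{Homeo}(\mathcal G^{(0)})$ be the topological full group: the group of all homeomorphisms $g$ for which there is a compact open bisection $B$ with $s(B)=r(B)$, $g(s(b))=r(b)$ for all $b\in B$, and $g(x)=x$ for all $x\notin s(B)$. Let the alternating group $\mathsf A(\mathcal G)$ be the subgroup of $\mathsf F(\mathcal G)$ generated by the elements $g\in\mathsf F(\mathcal G)$ of order three for which there are pairwise disjoint compact open sets $X_0,X_1,X_2\subseteq\mathcal G^{(0)}$ with $g(X_j)=X_{j+1}$ (indices modulo $3$) such that $g$ is the identity on $\mathcal G^{(0)}\setminus(X_0\cup X_1\cup X_2)$. Then for every integer $n>2$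 there exist $g_1,g_2\in\mathsf A(\mathcal G)$ such that $g_1$ has order $n$, $g_2$ has finite order, and $\mathsf A(\mathcal G)$ is generated by $\{g_1,g_2\}$. -/

import Mathlib

open Topology

/-- A groupoid, presented through its set `G` of arrows: a partially defined associative
multiplication and an everywhere defined involutive inverse. `Composable a b` says that the
product `a * b` is defined; the value of `a * b` has no meaning for other pairs. -/
class ArrowGroupoid (G : Type*) extends Mul G, Inv G where
  Composable : G → G → Prop
  inv_invol : ∀ a : G, (a⁻¹)⁻¹ = a
  composable_mul_left : ∀ a b c : G, Composable a b → Composable b c → Composable (a * b) c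
  composable_mul_right : ∀ a b c : G, Composable a b → Composable b c → Composable a (b * c)
  assoc : ∀ a b c : G, Composable a b → Composable b c → (a * b) * c = a * (b * c)
  composable_inv_right : ∀ a : G, Composable a a⁻¹
  composable_inv_left : ∀ a : G, Composable a⁻¹ a
  mul_mul_inv : ∀ a b : G, Composable a b → (a * b) * b⁻¹ = a
  inv_mul_mul : ∀ a b : G, Composable a b → a⁻¹ * (a * b) = b

/-- A topological groupoid: inversion is continuous, and multiplication is continuous on the
set of composable pairs (with the topology of `G × G`). -/
class TopologicalGroupoid (G : Type*) [TopologicalSpace G] extends ArrowGroupoid G where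
  continuous_inv : Continuous fun a : G => a⁻¹
  continuousOn_mul : ContinuousOn (fun p : G × G => p.1 * p.2) {p : G × G | Composable p.1 p.2}

namespace TopologicalGroupoid

open ArrowGroupoid

section Algebra

variable (G : Type*) [ArrowGroupoid G]

/-- The set `G⁽⁰⁾` of units, the elements of the form `γ γ⁻¹`. It is used as a type, and
carries the subspace topology. -/
def unitSpace : Set G := {u | ∃ a : G, a * a⁻¹ = u}

variable {G}

/-- The range map `r(γ) = γ γ⁻¹`. -/
def rng (a : G) : unitSpace G := ⟨a * a⁻¹, a, rfl⟩

/-- The source map `s(γ) = γ⁻¹ γ`. -/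
def src (a : G) : unitSpace G := ⟨a⁻¹ * a, a⁻¹, by rw [inv_invol]⟩

/-- The product of two sets of arrows: all defined products of an element of `A` and an
element of `B`. -/
def setMul (A B : Set G) : Set G :=
  {c | ∃ a ∈ A, ∃ b ∈ B, Composable a b ∧ c = a * b}

/-- The set `A⁻¹` of inverses of the elements of `A`. -/
def setInv (A : Set G) : Set G := (fun a : G => a⁻¹) '' A

/-- `setPow A n` is `A ^ (n + 1)`, the set of defined products of `n + 1` elements of `A`. -/
def setPow (A : Set G) : ℕ → Set G
  | 0 => A
  | n + 1 => setMul A (setPow A n)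

/-- `familyPow 𝓑 n` is `𝓑 ^ (n + 1)`, the collection of the products of `n + 1` members
of the collection `𝓑` of sets of arrows. -/
def familyPow (𝓑 : Set (Set G)) : ℕ → Set (Set G)
  | 0 => 𝓑
  | n + 1 => {C | ∃ A ∈ 𝓑, ∃ B ∈ familyPow 𝓑 n, C = setMul A B}

/-- The orbit `{r(γ) : s(γ) = x}` of a unit `x`. -/
def orbit (x : unitSpace G) : Set (unitSpace G) := {y | ∃ a : G, src a = x ∧ rng a = y}

/-- The isotropy group `{γ : r(γ) = s(γ) = x}` of a unit `x`, as a set of arrows. -/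
def isotropy (x : unitSpace G) : Set G := {a | rng a = x ∧ src a = x}

end Algebra

section Topological

variable {G : Type*} [TopologicalSpace G] [TopologicalGroupoid G]

/-- An open bisection: an open set of arrows on which the source and range maps restrict to
homeomorphisms onto open subsets of the unit space. -/
def IsBisection (B : Set G) : Prop :=
  IsOpen B ∧ IsOpenEmbedding (B.domRestrict (src : G → unitSpace G)) ∧
    IsOpenEmbedding (B.domRestrict (rng : G → unitSpace G))

/-- A compact open bisection. -/
def IsCompactBisection (B : Set G) : Prop := IsCompact B ∧ IsBisection B

variable (G)

/-- The groupoid is ample: the compact open bisections form a basis of its topology. -/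
def IsAmple : Prop := TopologicalSpace.IsTopologicalBasis {B : Set G | IsCompactBisection B}

/-- The unit space is a Cantor space. -/
def IsCantor : Prop := Nonempty (unitSpace G ≃ₜ (ℕ → Bool))

/-- The groupoid is minimal: every orbit is dense in the unit space. -/
def IsMinimal : Prop := ∀ x : unitSpace G, Dense (orbit x)

/-- The groupoid is essentially principal: the units with trivial isotropy group are dense. -/
def IsEssentiallyPrincipal : Prop := Dense {x : unitSpace G | isotropy x = {(x : G)}}

/-- The groupoid is purely infinite: every compact open set `X` of units is the source of two
compact open bisections whose ranges are disjoint subsets of `X`. -/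
def IsPurelyInfinite : Prop :=
  ∀ X : Set (unitSpace G), IsCompact X → IsOpen X →
    ∃ B B' : Set G, IsCompactBisection B ∧ IsCompactBisection B' ∧
      src '' B = X ∧ src '' B' = X ∧ Disjoint (rng '' B) (rng '' B') ∧
      rng '' B ⊆ X ∧ rng '' B' ⊆ X

variable {G}

/-- A generating set: `G` is the union of the sets `(K ∪ K⁻¹) ^ n`, `n ≥ 1`. -/
def IsGenerating (K : Set G) : Prop := ⋃ n : ℕ, setPow (K ∪ setInv K) n = Set.univ

/-- An expansive collection: finitely many compact open bisections such that the products of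
`n ≥ 1` members of `𝓑 ∪ 𝓑⁻¹` form a basis of the topology of `G`. -/
def IsExpansiveFamily (𝓑 : Set (Set G)) : Prop :=
  𝓑.Finite ∧ (∀ B ∈ 𝓑, IsCompactBisection B) ∧
    TopologicalSpace.IsTopologicalBasis (⋃ n : ℕ, familyPow (𝓑 ∪ setInv '' 𝓑) n)

variable (G)

/-- The groupoid is expansive: some compact generating set has an expansive finite cover. -/
def IsExpansive : Prop :=
  ∃ K : Set G, IsCompact K ∧ IsGenerating K ∧
    ∃ 𝓑 : Set (Set G), IsExpansiveFamily 𝓑 ∧ K ⊆ ⋃₀ 𝓑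

/-- The topological full group, as a set of homeomorphisms of the unit space: those which
agree, for some compact open bisection `B` with `s(B) = r(B)`, with the action `s(b) ↦ r(b)`
of `B` on `s(B)`, and which are the identity outside `s(B)`. -/
def topologicalFullGroup : Set (unitSpace G ≃ₜ unitSpace G) :=
  {g | ∃ B : Set G, IsCompactBisection B ∧ src '' B = rng '' B ∧
    (∀ b ∈ B, g (src b) = rng b) ∧ ∀ x ∉ src '' B, g x = x}

/-- The elements of order three of the topological full group that come from multisections:
they permute three disjoint compact open sets cyclically and fix all other units. -/
def multisectionElements : Set (unitSpace G ≃ₜ unitSpace G) :=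
  {g | g ∈ topologicalFullGroup G ∧ orderOf g = 3 ∧
    ∃ X : Fin 3 → Set (unitSpace G),
      (∀ j, IsCompact (X j) ∧ IsOpen (X j)) ∧ (∀ i j, i ≠ j → Disjoint (X i) (X j)) ∧
      (∀ j, g '' X j = X (j + 1)) ∧ ∀ x ∉ ⋃ j, X j, g x = x}

/-- The alternating group of a groupoid with infinite orbits, realised as a group of
homeomorphisms of the unit space. -/
def alternatingGroup : Subgroup (unitSpace G ≃ₜ unitSpace G) :=
  Subgroup.closure (multisectionElements G)

end Topological

end TopologicalGroupoid

/-!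
The two generators are explicit. The partial homeomorphisms of the unit space `X` given by compact
open bisections play the role of ring elements, and three-cycles that of elementary matrices.

Pure infiniteness gives any finite number of maps `e i : X → X`, each of them the action of a
compact open bisection, that are injective with pairwise disjoint images (`exists_copies`). A
partial map `f` with clopen domain `D` that comes from a compact open bisection (`IsLocal`) can be
placed between three of these copies, as the three-cycle `e i x ↦ e j (f x) ↦ e k (f x) ↦ e i x`
for `x ∈ D`. All such three-cycles lie in the alternating group (`hasTricycle_alternatingGroup`).
Let `H` be a group that contains the alternating group of the set of indices, acting by
permutation of the copies, and call `f` realized in `H` if its three-cycles belong to `H`.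
Commutators of three-cycles that overlap in a single place compose the maps, as with elementary
matrices, so the realized maps are closed under composition, inverses and unions
(`IsTricycle.commutator`, `ContainsAlternating.realized_comp`,
`ContainsAlternating.realized_of_leftInvOn`, `ContainsAlternating.realized_union`). If the
finitely many members of an expansive family are realized, then so are their products, which form
a basis of the topology, and then by compactness all compact open bisections (`IsLocal.realized`).
An arbitrary generator of the alternating group of the groupoid is the product of finitely many
three-cycles, each of whose maps takes values in a single copy or in the part of `X` outside all
of the copies, and such three-cycles are obtained from the realized ones by conjugation
(`alternatingGroup_le`). One three-cycle that connects the outer part to two copies is needed for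
this.

It remains to find two elements that produce all of this. The alternating group of a suitable
large set of indices is generated by an element `π` of order `n` and a cycle `ρ` of odd length
congruent to one modulo three, with as many fixed indices as desired
(`exists_generators_alternatingGroup`, from Jordan's theorem). On the copies fixed by `ρ` there is
room for an element `t` of order dividing three that carries simultaneously the three-cycles of
all members of the expansive family and the one through the outer part
(`exists_simultaneous_tricycles`). The generators are `g₁`, the action of `π`, and `g₂`, the
product of the commuting elements `t` and the action of `ρ`. Their orders are coprime, so both are
powers of `g₂`. The commutators of `t` with even permutations of the copies then isolate the
single three-cycles from `t` (`ContainsAlternating.realized_of_apply`).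
-/

namespace TopologicalGroupoid

open ArrowGroupoid Set

/-! ### Three-cycles of partial maps -/

section Tricycle

variable {X : Type*} [TopologicalSpace X]

/-- The homeomorphism `g` is the three-cycle `a x ↦ b x ↦ c x ↦ a x` for every `x ∈ D`, and the
identity elsewhere. The maps are total; their values outside `D` play no role. -/
structure IsTricycle (g : X ≃ₜ X) (D : Set X) (a b c : X → X) : Prop where
  map_fst : ∀ x ∈ D, g (a x) = b x
  map_snd : ∀ x ∈ D, g (b x) = c x
  map_trd : ∀ x ∈ D, g (c x) = a x
  fix : ∀ y, (∀ x ∈ D, y ≠ a x ∧ y ≠ b x ∧ y ≠ c x) → g y = y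

/-- The maps `a`, `b`, `c` are injective on `D` and have disjoint images there, so that a
three-cycle along them makes sense. -/
structure Separated {X : Type*} (D : Set X) (a b c : X → X) : Prop where
  inj_fst : InjOn a D
  inj_snd : InjOn b D
  inj_trd : InjOn c D
  fst_ne_snd : ∀ x ∈ D, ∀ y ∈ D, a x ≠ b y
  snd_ne_trd : ∀ x ∈ D, ∀ y ∈ D, b x ≠ c y
  trd_ne_fst : ∀ x ∈ D, ∀ y ∈ D, c x ≠ a y

lemma homeo_inv_apply_self (g : X ≃ₜ X) (x : X) : g⁻¹ (g x) = x := g.symm_apply_apply x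

lemma homeo_apply_inv_self (g : X ≃ₜ X) (x : X) : g (g⁻¹ x) = x := g.apply_symm_apply x

lemma homeo_inv_apply_eq {g : X ≃ₜ X} {x y : X} (h : g x = y) : g⁻¹ y = x := by
  rw [← h, homeo_inv_apply_self]

namespace IsTricycle

variable {g h : X ≃ₜ X} {D D' : Set X} {a b c : X → X}

lemma rotate (hg : IsTricycle g D a b c) : IsTricycle g D b c a :=
  ⟨hg.map_snd, hg.map_trd, hg.map_fst, fun y hy => hg.fix y fun x hx =>
    ⟨(hy x hx).2.2, (hy x hx).1, (hy x hx).2.1⟩⟩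

lemma inv (hg : IsTricycle g D a b c) : IsTricycle g⁻¹ D a c b :=
  ⟨fun x hx => homeo_inv_apply_eq (hg.map_trd x hx),
    fun x hx => homeo_inv_apply_eq (hg.map_snd x hx),
    fun x hx => homeo_inv_apply_eq (hg.map_fst x hx),
    fun y hy => homeo_inv_apply_eq (hg.fix y fun x hx =>
      ⟨(hy x hx).1, (hy x hx).2.2, (hy x hx).2.1⟩)⟩

lemma unique (hg : IsTricycle g D a b c) (hh : IsTricycle h D a b c) : g = h := by
  ext y
  by_cases hy : ∀ x ∈ D, y ≠ a x ∧ y ≠ b x ∧ y ≠ c x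
  · rw [hg.fix y hy, hh.fix y hy]
  · push Not at hy
    obtain ⟨x, hx, hxy⟩ := hy
    by_cases h1 : y = a x
    · rw [h1, hg.map_fst x hx, hh.map_fst x hx]
    by_cases h2 : y = b x
    · rw [h2, hg.map_snd x hx, hh.map_snd x hx]
    rw [hxy h1 h2, hg.map_trd x hx, hh.map_trd x hx]

lemma conj (hg : IsTricycle g D a b c) (h : X ≃ₜ X) :
    IsTricycle (h * g * h⁻¹) D (h ∘ a) (h ∘ b) (h ∘ c) := by
  refine ⟨fun x hx => ?_, fun x hx => ?_, fun x hx => ?_, fun y hy => ?_⟩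
  · simp only [Homeomorph.mul_apply, Function.comp, homeo_inv_apply_self, hg.map_fst x hx]
  · simp only [Homeomorph.mul_apply, Function.comp, homeo_inv_apply_self, hg.map_snd x hx]
  · simp only [Homeomorph.mul_apply, Function.comp, homeo_inv_apply_self, hg.map_trd x hx]
  · rw [Homeomorph.mul_apply, Homeomorph.mul_apply, hg.fix, homeo_apply_inv_self]
    intro x hx
    refine ⟨fun e => (hy x hx).1 ?_, fun e => (hy x hx).2.1 ?_, fun e => (hy x hx).2.2 ?_⟩ <;>
    rw [Function.comp, ← e, homeo_apply_inv_self]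

lemma congr {a' b' c' : X → X} (hg : IsTricycle g D a b c) (ha : EqOn a a' D) (hb : EqOn b b' D)
    (hc : EqOn c c' D) : IsTricycle g D a' b' c' :=
  ⟨fun x hx => by rw [← ha hx, ← hb hx, hg.map_fst x hx],
    fun x hx => by rw [← hb hx, ← hc hx, hg.map_snd x hx],
    fun x hx => by rw [← hc hx, ← ha hx, hg.map_trd x hx],
    fun y hy => hg.fix y fun x hx => by rw [ha hx, hb hx, hc hx]; exact hy x hx⟩

lemma comp_right {φ : X → X} (hg : IsTricycle g (φ '' D) a b c) :
    IsTricycle g D (a ∘ φ) (b ∘ φ) (c ∘ φ) :=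
  ⟨fun x hx => hg.map_fst _ (mem_image_of_mem _ hx),
    fun x hx => hg.map_snd _ (mem_image_of_mem _ hx),
    fun x hx => hg.map_trd _ (mem_image_of_mem _ hx),
    fun y hy => hg.fix y (by rintro _ ⟨x, hx, rfl⟩; exact hy x hx)⟩

lemma mul_disjoint (hg : IsTricycle g D a b c) (hh : IsTricycle h D' a b c)
    (hD : Disjoint D D') (hs : Separated (D ∪ D') a b c) :
    IsTricycle (g * h) (D ∪ D') a b c := by
  have hne : ∀ x ∈ D, ∀ y ∈ D', x ≠ y := fun x hx y hy e =>
    disjoint_left.1 hD hx (e ▸ hy)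
  have key : ∀ x ∈ D, ∀ y ∈ D', a x ≠ a y ∧ a x ≠ b y ∧ a x ≠ c y ∧ b x ≠ a y ∧ b x ≠ b y ∧
      b x ≠ c y ∧ c x ≠ a y ∧ c x ≠ b y ∧ c x ≠ c y := fun x hx y hy =>
    have hx' : x ∈ D ∪ D' := Or.inl hx
    have hy' : y ∈ D ∪ D' := Or.inr hy
    ⟨fun e => hne x hx y hy (hs.inj_fst hx' hy' e), hs.fst_ne_snd x hx' y hy',
      (hs.trd_ne_fst y hy' x hx').symm, (hs.fst_ne_snd y hy' x hx').symm,
      fun e => hne x hx y hy (hs.inj_snd hx' hy' e), hs.snd_ne_trd x hx' y hy',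
      hs.trd_ne_fst x hx' y hy', (hs.snd_ne_trd y hy' x hx').symm,
      fun e => hne x hx y hy (hs.inj_trd hx' hy' e)⟩
  refine ⟨?_, ?_, ?_, ?_⟩
  · rintro x (hx | hx) <;> rw [Homeomorph.mul_apply]
    · rw [hh.fix (a x), hg.map_fst x hx]
      intro y hy; have := key x hx y hy; tauto
    · rw [hh.map_fst x hx, hg.fix]
      intro y hy; have := key y hy x hx; simp only [ne_comm (a := b x)]; tauto
  · rintro x (hx | hx) <;> rw [Homeomorph.mul_apply]
    · rw [hh.fix (b x), hg.map_snd x hx]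
      intro y hy; have := key x hx y hy; tauto
    · rw [hh.map_snd x hx, hg.fix]
      intro y hy; have := key y hy x hx; simp only [ne_comm (a := c x)]; tauto
  · rintro x (hx | hx) <;> rw [Homeomorph.mul_apply]
    · rw [hh.fix (c x), hg.map_trd x hx]
      intro y hy; have := key x hx y hy; tauto
    · rw [hh.map_trd x hx, hg.fix]
      intro y hy; have := key y hy x hx; simp only [ne_comm (a := a x)]; tauto
  · intro y hy
    rw [Homeomorph.mul_apply, hh.fix y fun x hx => hy x (Or.inr hx),
      hg.fix y fun x hx => hy x (Or.inl hx)]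

/-- The restriction of a three-cycle to the complement of a smaller domain. -/
lemma mul_inv_subset (hg : IsTricycle g D a b c) (hh : IsTricycle h D' a b c)
    (hD : D' ⊆ D) (hs : Separated D a b c) : IsTricycle (g * h⁻¹) (D \ D') a b c := by
  have hh' := hh.inv
  have key : ∀ x ∈ D \ D', ∀ y ∈ D', a x ≠ a y ∧ a x ≠ b y ∧ a x ≠ c y ∧ b x ≠ a y ∧ b x ≠ b y ∧
      b x ≠ c y ∧ c x ≠ a y ∧ c x ≠ b y ∧ c x ≠ c y := fun x hx y hy =>
    have hne : x ≠ y := fun e => hx.2 (e ▸ hy)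
    ⟨fun e => hne (hs.inj_fst hx.1 (hD hy) e), hs.fst_ne_snd x hx.1 y (hD hy),
      (hs.trd_ne_fst y (hD hy) x hx.1).symm, (hs.fst_ne_snd y (hD hy) x hx.1).symm,
      fun e => hne (hs.inj_snd hx.1 (hD hy) e), hs.snd_ne_trd x hx.1 y (hD hy),
      hs.trd_ne_fst x hx.1 y (hD hy), (hs.snd_ne_trd y (hD hy) x hx.1).symm,
      fun e => hne (hs.inj_trd hx.1 (hD hy) e)⟩
  refine ⟨fun x hx => ?_, fun x hx => ?_, fun x hx => ?_, fun y hy => ?_⟩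
  · rw [Homeomorph.mul_apply, hh'.fix, hg.map_fst x hx.1]
    intro y hy; have := key x hx y hy; tauto
  · rw [Homeomorph.mul_apply, hh'.fix, hg.map_snd x hx.1]
    intro y hy; have := key x hx y hy; tauto
  · rw [Homeomorph.mul_apply, hh'.fix, hg.map_trd x hx.1]
    intro y hy; have := key x hx y hy; tauto
  · rw [Homeomorph.mul_apply]
    by_cases h1 : ∀ x ∈ D', y ≠ a x ∧ y ≠ b x ∧ y ≠ c x
    · rw [hh'.fix y fun x hx => ⟨(h1 x hx).1, (h1 x hx).2.2, (h1 x hx).2.1⟩, hg.fix]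
      intro x hx
      by_cases hx' : x ∈ D'
      · exact h1 x hx'
      · exact hy x ⟨hx, hx'⟩
    · push Not at h1
      obtain ⟨x, hx, hxy⟩ := h1
      by_cases h2 : y = a x
      · rw [h2, hh'.map_fst x hx, hg.map_trd x (hD hx)]
      by_cases h3 : y = b x
      · rw [h3, hh'.map_trd x hx, hg.map_fst x (hD hx)]
      rw [hxy h2 h3, hh'.map_snd x hx, hg.map_snd x (hD hx)]

/-- If `h` moves, among the points of the three-cycle `g`, only the points `a x` with `x ∈ D'`,
then the commutator of `h` and `g` is the three-cycle through `a x`, `h (a x)` and `b x`. This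
restricts the domain and replaces one of the three maps at the same time. -/
lemma commutator (hg : IsTricycle g D a b c) {d : X → X} (hD : D' ⊆ D)
    (h1 : ∀ x ∈ D', h (a x) = d x) (h2 : ∀ x ∈ D, x ∉ D' → h (a x) = a x)
    (h3 : ∀ x ∈ D, h (b x) = b x) (h4 : ∀ x ∈ D, h (c x) = c x)
    (h5 : ∀ x ∈ D', ∀ y ∈ D, d x ≠ a y ∧ d x ≠ b y ∧ d x ≠ c y)
    (h6 : ∀ x ∈ D', ∀ y ∈ D, h⁻¹ (a x) ≠ a y ∧ h⁻¹ (a x) ≠ b y ∧ h⁻¹ (a x) ≠ c y) :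
    IsTricycle (h * g * h⁻¹ * g⁻¹) D' a d b := by
  have hg' := hg.inv
  have i3 : ∀ x ∈ D, h⁻¹ (b x) = b x := fun x hx => homeo_inv_apply_eq (h3 x hx)
  have i4 : ∀ x ∈ D, h⁻¹ (c x) = c x := fun x hx => homeo_inv_apply_eq (h4 x hx)
  refine ⟨fun x hx => ?_, fun x hx => ?_, fun x hx => ?_, fun y hy => ?_⟩
  · simp only [Homeomorph.mul_apply]
    rw [hg'.map_fst x (hD hx), i4 x (hD hx), hg.map_trd x (hD hx), h1 x hx]
  · simp only [Homeomorph.mul_apply]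
    rw [hg'.fix (d x) fun y hy => ⟨(h5 x hx y hy).1, (h5 x hx y hy).2.2, (h5 x hx y hy).2.1⟩,
      homeo_inv_apply_eq (h1 x hx), hg.map_fst x (hD hx), h3 x (hD hx)]
  · simp only [Homeomorph.mul_apply]
    rw [hg'.map_trd x (hD hx), hg.fix _ (h6 x hx), homeo_apply_inv_self]
  · simp only [Homeomorph.mul_apply]
    by_cases hy' : ∀ x ∈ D, y ≠ a x ∧ y ≠ b x ∧ y ≠ c x
    · rw [hg'.fix y fun x hx => ⟨(hy' x hx).1, (hy' x hx).2.2, (hy' x hx).2.1⟩, hg.fix,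
        homeo_apply_inv_self]
      intro x hx
      have hx' := hy' x hx
      refine ⟨fun e => ?_, fun e => ?_, fun e => ?_⟩
      · have e' : y = h (a x) := by rw [← e, homeo_apply_inv_self]
        by_cases hxD : x ∈ D'
        · exact (hy x hxD).2.1 (e'.trans (h1 x hxD))
        · exact hx'.1 (e'.trans (h2 x hx hxD))
      · exact hx'.2.1 (by rw [← h3 x hx, ← e, homeo_apply_inv_self])
      · exact hx'.2.2 (by rw [← h4 x hx, ← e, homeo_apply_inv_self])
    · push Not at hy'
      obtain ⟨x, hx, hxy⟩ := hy'
      have ha : x ∉ D' → h⁻¹ (a x) = a x := fun hx' => homeo_inv_apply_eq (h2 x hx hx')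
      by_cases e1 : y = a x
      · have hx' : x ∉ D' := fun hx' => (hy x hx').1 e1
        rw [e1, hg'.map_fst x hx, i4 x hx, hg.map_trd x hx, h2 x hx hx']
      by_cases e2 : y = b x
      · have hx' : x ∉ D' := fun hx' => (hy x hx').2.2 e2
        rw [e2, hg'.map_trd x hx, ha hx', hg.map_fst x hx, h3 x hx]
      · rw [hxy e1 e2, hg'.map_snd x hx, i3 x hx, hg.map_snd x hx, h4 x hx]

end IsTricycle

namespace Separated

variable {X : Type*} {D D' : Set X} {a b c : X → X}

lemma mono (hs : Separated D a b c) (h : D' ⊆ D) : Separated D' a b c :=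
  ⟨hs.inj_fst.mono h, hs.inj_snd.mono h, hs.inj_trd.mono h,
    fun x hx y hy => hs.fst_ne_snd x (h hx) y (h hy),
    fun x hx y hy => hs.snd_ne_trd x (h hx) y (h hy),
    fun x hx y hy => hs.trd_ne_fst x (h hx) y (h hy)⟩

end Separated

/-- The subgroup `H` contains the three-cycle along `a`, `b`, `c` with domain `D`. -/
def HasTricycle (H : Subgroup (X ≃ₜ X)) (D : Set X) (a b c : X → X) : Prop :=
  ∃ g ∈ H, IsTricycle g D a b c

namespace HasTricycle

variable {H : Subgroup (X ≃ₜ X)} {D D' : Set X} {a b c : X → X}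

lemma rotate (hg : HasTricycle H D a b c) : HasTricycle H D b c a :=
  let ⟨g, h, hg⟩ := hg
  ⟨g, h, hg.rotate⟩

lemma swap (hg : HasTricycle H D a b c) : HasTricycle H D a c b :=
  let ⟨g, h, hg⟩ := hg
  ⟨g⁻¹, H.inv_mem h, hg.inv⟩

lemma congr {a' b' c' : X → X} (hg : HasTricycle H D a b c) (ha : EqOn a a' D)
    (hb : EqOn b b' D) (hc : EqOn c c' D) : HasTricycle H D a' b' c' :=
  let ⟨g, h, hg⟩ := hg
  ⟨g, h, hg.congr ha hb hc⟩

lemma comp_right {φ : X → X} (hg : HasTricycle H (φ '' D) a b c) :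
    HasTricycle H D (a ∘ φ) (b ∘ φ) (c ∘ φ) :=
  let ⟨g, h, hg⟩ := hg
  ⟨g, h, hg.comp_right⟩

lemma conj (hg : HasTricycle H D a b c) {h : X ≃ₜ X} (hh : h ∈ H) :
    HasTricycle H D (h ∘ a) (h ∘ b) (h ∘ c) :=
  let ⟨g, h', hg⟩ := hg
  ⟨h * g * h⁻¹, H.mul_mem (H.mul_mem hh h') (H.inv_mem hh), hg.conj h⟩

lemma empty (H : Subgroup (X ≃ₜ X)) (a b c : X → X) : HasTricycle H ∅ a b c :=
  ⟨1, H.one_mem, by simp, by simp, by simp, fun _ _ => rfl⟩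

lemma union_disjoint (hg : HasTricycle H D a b c) (hh : HasTricycle H D' a b c)
    (hD : Disjoint D D') (hs : Separated (D ∪ D') a b c) : HasTricycle H (D ∪ D') a b c :=
  let ⟨_, h1, hg⟩ := hg
  let ⟨_, h2, hh⟩ := hh
  ⟨_, H.mul_mem h1 h2, hg.mul_disjoint hh hD hs⟩

lemma diff (hg : HasTricycle H D a b c) (hh : HasTricycle H D' a b c)
    (hD : D' ⊆ D) (hs : Separated D a b c) : HasTricycle H (D \ D') a b c :=
  let ⟨_, h1, hg⟩ := hg
  let ⟨_, h2, hh⟩ := hh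
  ⟨_, H.mul_mem h1 (H.inv_mem h2), hg.mul_inv_subset hh hD hs⟩

/-- If the domains overlap, the three-cycle along the union is a product of three factors: the
two given ones and the inverse of the one along the intersection. -/
lemma union (hg : HasTricycle H D a b c) (hh : HasTricycle H D' a b c)
    (hi : HasTricycle H (D ∩ D') a b c) (hs : Separated (D ∪ D') a b c) :
    HasTricycle H (D ∪ D') a b c := by
  have h1 : HasTricycle H (D' \ (D ∩ D')) a b c :=
    hh.diff hi inter_subset_right (hs.mono subset_union_right)
  have e : D' \ (D ∩ D') = D' \ D := by ext; simp
  rw [e] at h1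
  have := hg.union_disjoint h1 disjoint_sdiff_right (by simpa using hs)
  simpa using this

lemma biUnion {κ : Type*} {s : Finset κ} {D : κ → Set X}
    (h : ∀ k ∈ s, HasTricycle H (D k) a b c)
    (hd : ∀ k ∈ s, ∀ l ∈ s, k ≠ l → Disjoint (D k) (D l))
    (hs : Separated (⋃ k ∈ s, D k) a b c) : HasTricycle H (⋃ k ∈ s, D k) a b c := by
  classical
  induction s using Finset.induction_on with
  | empty => simpa using empty H a b c
  | insert k s hk ih =>
    rw [Finset.set_biUnion_insert] at hs ⊢
    refine (h k (Finset.mem_insert_self k s)).union_disjoint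
      (ih (fun l hl => h l (Finset.mem_insert_of_mem hl)) (fun l hl l' hl' =>
        hd l (Finset.mem_insert_of_mem hl) l' (Finset.mem_insert_of_mem hl'))
        (hs.mono subset_union_right)) ?_ hs
    rw [disjoint_iUnion₂_right]
    exact fun l hl => hd k (Finset.mem_insert_self k s) l (Finset.mem_insert_of_mem hl)
      (fun e => hk (e ▸ hl))

lemma commutator (hg : HasTricycle H D a b c) {h : X ≃ₜ X} (hh : h ∈ H)
    {d : X → X} (hD : D' ⊆ D)
    (h1 : ∀ x ∈ D', h (a x) = d x) (h2 : ∀ x ∈ D, x ∉ D' → h (a x) = a x)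
    (h3 : ∀ x ∈ D, h (b x) = b x) (h4 : ∀ x ∈ D, h (c x) = c x)
    (h5 : ∀ x ∈ D', ∀ y ∈ D, d x ≠ a y ∧ d x ≠ b y ∧ d x ≠ c y)
    (h6 : ∀ x ∈ D', ∀ y ∈ D, h⁻¹ (a x) ≠ a y ∧ h⁻¹ (a x) ≠ b y ∧ h⁻¹ (a x) ≠ c y) :
    HasTricycle H D' a d b :=
  let ⟨g, hgH, hg⟩ := hg
  ⟨h * g * h⁻¹ * g⁻¹, H.mul_mem (H.mul_mem (H.mul_mem hh hgH) (H.inv_mem hh)) (H.inv_mem hgH),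
    hg.commutator hD h1 h2 h3 h4 h5 h6⟩

end HasTricycle

end Tricycle

/-! ### Matrix-like calculus of three-cycles along disjoint copies of the space -/

section Copies

variable {X ι : Type*} [TopologicalSpace X] {e : ι → X → X} {H : Subgroup (X ≃ₜ X)}
  {D D' Z : Set X} {f f' a b c : X → X} {i j k l p q : ι}

/-- The homeomorphism `g` permutes the copies `e i '' univ` of `X` in the way prescribed by `σ`,
and is the identity elsewhere. -/
structure PermutesCopies (e : ι → X → X) (g : X ≃ₜ X) (σ : Equiv.Perm ι) : Prop where
  map : ∀ i x, g (e i x) = e (σ i) x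
  fix : ∀ y, (∀ i x, y ≠ e i x) → g y = y

namespace PermutesCopies

variable {g h : X ≃ₜ X} {σ τ : Equiv.Perm ι}

lemma one (e : ι → X → X) : PermutesCopies e 1 1 := ⟨fun _ _ => rfl, fun _ _ => rfl⟩

lemma mul (hg : PermutesCopies e g σ) (hh : PermutesCopies e h τ) :
    PermutesCopies e (g * h) (σ * τ) :=
  ⟨fun i x => by rw [Homeomorph.mul_apply, hh.map, hg.map]; rfl,
    fun y hy => by rw [Homeomorph.mul_apply, hh.fix y hy, hg.fix y hy]⟩

lemma inv (hg : PermutesCopies e g σ) : PermutesCopies e g⁻¹ σ⁻¹ :=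
  ⟨fun i x => homeo_inv_apply_eq (by rw [hg.map]; simp),
    fun y hy => homeo_inv_apply_eq (hg.fix y hy)⟩

lemma pow (hg : PermutesCopies e g σ) (n : ℕ) : PermutesCopies e (g ^ n) (σ ^ n) := by
  induction n with
  | zero => simpa using one e
  | succ n ih => rw [pow_succ, pow_succ]; exact ih.mul hg

lemma unique (hg : PermutesCopies e g σ) (hh : PermutesCopies e h σ) : g = h := by
  ext y
  by_cases hy : ∀ i x, y ≠ e i x
  · rw [hg.fix y hy, hh.fix y hy]
  · push Not at hy
    obtain ⟨i, x, rfl⟩ := hy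
    rw [hg.map, hh.map]

lemma orderOf_eq [Nonempty X] (he : Function.Injective (Function.uncurry e))
    (hg : PermutesCopies e g σ) : orderOf g = orderOf σ := by
  refine orderOf_eq_orderOf_iff.2 fun n => ⟨fun h => ?_, fun h => ?_⟩
  · ext i
    obtain ⟨x⟩ := ‹Nonempty X›
    have h1 := (hg.pow n).map i x
    rw [h] at h1
    exact (Prod.ext_iff.1 (@he (i, x) ((σ ^ n) i, x) h1)).1.symm
  · have h1 := hg.pow n
    rw [h] at h1
    exact h1.unique (one e)

end PermutesCopies

lemma IsTricycle.permutesCopies [DecidableEq ι] {g : X ≃ₜ X}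
    (he : Function.Injective (Function.uncurry e)) (hij : i ≠ j) (hik : i ≠ k) (hjk : j ≠ k)
    (hg : IsTricycle g univ (e i) (e j) (e k)) :
    PermutesCopies e g (Equiv.swap i k * Equiv.swap i j) := by
  have hne : ∀ {i j : ι}, i ≠ j → ∀ x y, e i x ≠ e j y := fun h x y h' =>
    h (Prod.ext_iff.1 (@he (_, x) (_, y) h')).1
  refine ⟨fun l x => ?_, fun y hy => hg.fix y fun x _ => ⟨hy i x, hy j x, hy k x⟩⟩
  rw [Equiv.Perm.mul_apply]
  by_cases h1 : l = i
  · rw [h1, hg.map_fst x trivial, Equiv.swap_apply_left,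
      Equiv.swap_apply_of_ne_of_ne hij.symm hjk]
  by_cases h2 : l = j
  · rw [h2, hg.map_snd x trivial, Equiv.swap_apply_right, Equiv.swap_apply_left]
  by_cases h3 : l = k
  · rw [h3, hg.map_trd x trivial, Equiv.swap_apply_of_ne_of_ne hik.symm hjk.symm,
      Equiv.swap_apply_right]
  rw [Equiv.swap_apply_of_ne_of_ne h1 h2, Equiv.swap_apply_of_ne_of_ne h1 h3]
  exact hg.fix _ fun y _ => ⟨hne h1 x y, hne h2 x y, hne h3 x y⟩

lemma PermutesCopies.isTricycle [DecidableEq ι] {g : X ≃ₜ X}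
    (hij : i ≠ j) (hik : i ≠ k) (hjk : j ≠ k)
    (hg : PermutesCopies e g (Equiv.swap i k * Equiv.swap i j)) :
    IsTricycle g univ (e i) (e j) (e k) := by
  refine ⟨fun x _ => ?_, fun x _ => ?_, fun x _ => ?_, fun y hy => ?_⟩
  · rw [hg.map, Equiv.Perm.mul_apply, Equiv.swap_apply_left,
      Equiv.swap_apply_of_ne_of_ne hij.symm hjk]
  · rw [hg.map, Equiv.Perm.mul_apply, Equiv.swap_apply_right, Equiv.swap_apply_left]
  · rw [hg.map, Equiv.Perm.mul_apply, Equiv.swap_apply_of_ne_of_ne hik.symm hjk.symm,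
      Equiv.swap_apply_right]
  · by_cases h : ∀ i x, y ≠ e i x
    · exact hg.fix y h
    · push Not at h
      obtain ⟨l, x, rfl⟩ := h
      have hl := hy x trivial
      have h1 : l ≠ i := fun h => hl.1 (by rw [h])
      have h2 : l ≠ j := fun h => hl.2.1 (by rw [h])
      have h3 : l ≠ k := fun h => hl.2.2 (by rw [h])
      rw [hg.map, Equiv.Perm.mul_apply, Equiv.swap_apply_of_ne_of_ne h1 h2,
        Equiv.swap_apply_of_ne_of_ne h1 h3]

lemma separated_copies {X ι : Type*} {e : ι → X → X} {D : Set X} {f : X → X} {i j k : ι}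
    (he : Function.Injective (Function.uncurry e)) (hf : InjOn f D)
    (hij : i ≠ j) (hik : i ≠ k) (hjk : j ≠ k) : Separated D (e i) (e j ∘ f) (e k ∘ f) := by
  have hne : ∀ {i j : ι}, i ≠ j → ∀ x y, e i x ≠ e j y := fun h x y h' =>
    h (Prod.ext_iff.1 (@he (_, x) (_, y) h')).1
  have hinj : ∀ i, Function.Injective (e i) := fun i x y h =>
    (Prod.ext_iff.1 (@he (i, x) (i, y) h)).2
  exact ⟨(hinj i).injOn, (hinj j).comp_injOn hf, (hinj k).comp_injOn hf,
    fun x _ y _ => hne hij _ _, fun x _ y _ => hne hjk _ _, fun x _ y _ => hne hik.symm _ _⟩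

/-- A group `H` of homeomorphisms that contains the alternating group of a large number of
disjoint copies of `X`. With at least eight copies there are always enough unused indices for the
computations with commutators. -/
structure ContainsAlternating [Fintype ι] [DecidableEq ι] (H : Subgroup (X ≃ₜ X))
    (e : ι → X → X) : Prop where
  injective : Function.Injective (Function.uncurry e)
  card : 8 ≤ Fintype.card ι
  exists_mem : ∀ σ ∈ _root_.alternatingGroup ι, ∃ g ∈ H, PermutesCopies e g σ

/-- The partial map `f` with domain `D` is realized in `H`: like an elementary matrix, it can be
placed between any two of the copies of `X`, in the form of a three-cycle in `H`. -/
structure Realized (H : Subgroup (X ≃ₜ X)) (e : ι → X → X) (D : Set X) (f : X → X) : Prop where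
  injOn : InjOn f D
  hasTricycle : ∀ i j k, i ≠ j → i ≠ k → j ≠ k → HasTricycle H D (e i) (e j ∘ f) (e k ∘ f)

lemma Realized.congr (h1 : Realized H e D f) (h : EqOn f f' D) : Realized H e D f' :=
  ⟨h1.injOn.congr h, fun i j k hij hik hjk => (h1.hasTricycle i j k hij hik hjk).congr
    (fun _ _ => rfl) (fun x hx => by simp only [Function.comp, h hx])
    fun x hx => by simp only [Function.comp, h hx]⟩

/-- Three-cycles that share two of their maps combine by conjugation. -/
lemma HasTricycle.of_common {u v : X → X} (ha : HasTricycle H D a u v) (hb : HasTricycle H D b u v)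
    (hc : HasTricycle H D c u v) (hs : Separated D a b c)
    (hau : ∀ x ∈ D, ∀ y ∈ D, a x ≠ u y ∧ a x ≠ v y)
    (hbu : ∀ x ∈ D, ∀ y ∈ D, b x ≠ u y ∧ b x ≠ v y) : HasTricycle H D a b c := by
  obtain ⟨h, hh, ht⟩ := hb
  obtain ⟨h', hh', ht'⟩ := hc
  have h1 : HasTricycle H D a v b := (ha.conj hh).congr
    (fun x hx => ht.fix _ fun y hy => ⟨hs.fst_ne_snd x hx y hy, hau x hx y hy⟩)
    (fun x hx => ht.map_snd x hx) (fun x hx => ht.map_trd x hx)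
  exact ((h1.conj hh').congr
    (fun x hx => ht'.fix _ fun y hy => ⟨(hs.trd_ne_fst y hy x hx).symm, hau x hx y hy⟩)
    (fun x hx => ht'.map_trd x hx)
    (fun x hx => ht'.fix _ fun y hy => ⟨hs.snd_ne_trd x hx y hy, hbu x hx y hy⟩)).swap

variable [Fintype ι] [DecidableEq ι]

lemma exists_mem_alternatingGroup_map (hc : 5 ≤ Fintype.card ι) {i' j' k' : ι} (hij : i ≠ j)
    (hik : i ≠ k) (hjk : j ≠ k) (hij' : i' ≠ j') (hik' : i' ≠ k') (hjk' : j' ≠ k') :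
    ∃ σ ∈ _root_.alternatingGroup ι, σ i = i' ∧ σ j = j' ∧ σ k = k' := by
  have h := alternatingGroup.isMultiplyPretransitive ι
  have h3 : MulAction.IsMultiplyPretransitive (_root_.alternatingGroup ι) ι 3 :=
    MulAction.isMultiplyPretransitive_of_le (n := Nat.card ι - 2)
      (by rw [Nat.card_eq_fintype_card]; omega) (by rw [Nat.card_eq_fintype_card]; omega)
  have emb : ∀ {i j k : ι}, i ≠ j → i ≠ k → j ≠ k → Function.Injective ![i, j, k] := by
    intro i j k h1 h2 h3 x y hxy
    fin_cases x <;> fin_cases y <;> simp_all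
  obtain ⟨⟨σ, hσ⟩, h⟩ := h3.exists_smul_eq ⟨_, emb hij hik hjk⟩ ⟨_, emb hij' hik' hjk'⟩
  refine ⟨σ, hσ, ?_, ?_, ?_⟩
  · exact DFunLike.congr_fun h 0
  · exact DFunLike.congr_fun h 1
  · exact DFunLike.congr_fun h 2

namespace ContainsAlternating

variable (hH : ContainsAlternating H e)
include hH

lemma apply_eq_iff {i j : ι} {x y : X} : e i x = e j y ↔ i = j ∧ x = y :=
  ⟨fun h => Prod.ext_iff.1 (hH.injective (a₁ := (i, x)) (a₂ := (j, y)) h),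
    fun h => by rw [h.1, h.2]⟩

/-- Eight different indices, to choose from in the computations with commutators. -/
lemma exists_embedding : ∃ w : Fin 8 → ι, Function.Injective w ∧
    ∀ i j x y, e (w i) x = e (w j) y ↔ i = j ∧ x = y := by
  obtain ⟨w⟩ := Function.Embedding.nonempty_of_card_le (α := Fin 8) (β := ι)
    (by simpa using hH.card)
  exact ⟨w, w.injective, fun i j x y => by rw [hH.apply_eq_iff, w.injective.eq_iff]⟩

lemma hasTricycle (hij : i ≠ j) (hik : i ≠ k) (hjk : j ≠ k) :
    HasTricycle H univ (e i) (e j) (e k) := by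
  obtain ⟨g, hg, h⟩ := hH.exists_mem _
    (Equiv.Perm.isThreeCycle_swap_mul_swap_same hik hij hjk.symm).mem_alternatingGroup
  exact ⟨g, hg, h.isTricycle hij hik hjk⟩

lemma realized_of_hasTricycle (hf : InjOn f D) (hij : i ≠ j) (hik : i ≠ k) (hjk : j ≠ k)
    (h : HasTricycle H D (e i) (e j ∘ f) (e k ∘ f)) : Realized H e D f := by
  refine ⟨hf, fun i' j' k' hij' hik' hjk' => ?_⟩
  obtain ⟨σ, hσ, hi, hj, hk⟩ := exists_mem_alternatingGroup_map (by have := hH.card; omega)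
    hij hik hjk hij' hik' hjk'
  obtain ⟨g, hg, hgσ⟩ := hH.exists_mem σ hσ
  refine (h.conj hg).congr (fun x _ => ?_) (fun x _ => ?_) fun x _ => ?_
  · simp only [Function.comp, hgσ.map, hi]
  · simp only [Function.comp, hgσ.map, hj]
  · simp only [Function.comp, hgσ.map, hk]

/-- Moving one of the three maps of a three-cycle to another copy. -/
lemma hasTricycle_move (hg : HasTricycle H D (e i ∘ f) b c) (hij : i ≠ j)
    (hil : i ≠ l) (hjl : j ≠ l)
    (hb : ∀ x ∈ D, ∀ y, b x ≠ e i y ∧ b x ≠ e j y ∧ b x ≠ e l y)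
    (hc : ∀ x ∈ D, ∀ y, c x ≠ e i y ∧ c x ≠ e j y ∧ c x ≠ e l y) :
    HasTricycle H D (e i ∘ f) (e j ∘ f) b := by
  obtain ⟨h, hh, ht⟩ := hH.hasTricycle hij hil hjl
  refine hg.commutator hh subset_rfl (fun x _ => ht.map_fst _ trivial)
    (fun x hx hx' => (hx' hx).elim)
    (fun x hx => ht.fix _ fun y _ => hb x hx y) (fun x hx => ht.fix _ fun y _ => hc x hx y)
    (fun x hx y hy => ⟨?_, ((hb y hy _).2.1).symm, ((hc y hy _).2.1).symm⟩) fun x hx y hy => ?_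
  · simp [hH.apply_eq_iff, hij.symm]
  · rw [Function.comp, homeo_inv_apply_eq (ht.map_trd (f x) trivial)]
    exact ⟨by simp [hH.apply_eq_iff, hil.symm], ((hb y hy _).2.2).symm, ((hc y hy _).2.2).symm⟩

lemma realized_comp (h1 : Realized H e D f) (h2 : Realized H e D' f') :
    Realized H e (D ∩ f ⁻¹' D') (f' ∘ f) := by
  obtain ⟨w, hwi, hw⟩ := hH.exists_embedding
  have ne : ∀ {i j : Fin 8}, i ≠ j → w i ≠ w j := fun h => hwi.ne h
  have inj : InjOn (f' ∘ f) (D ∩ f ⁻¹' D') :=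
    h2.injOn.comp (h1.injOn.mono inter_subset_left) fun x hx => hx.2
  refine hH.realized_of_hasTricycle inj (ne (i := 0) (j := 3) (by decide))
    (ne (i := 0) (j := 4) (by decide)) (ne (by decide)) ?_
  obtain ⟨h, hh, ht⟩ := h2.hasTricycle (w 1) (w 3) (w 4) (ne (by decide)) (ne (by decide))
    (ne (by decide))
  -- the commutator with `h` replaces `f` by `f' ∘ f`
  have h3 : HasTricycle H (D ∩ f ⁻¹' D') (e (w 1) ∘ f) (e (w 3) ∘ f' ∘ f) (e (w 0)) := by
    refine (h1.hasTricycle (w 0) (w 1) (w 2) (ne (by decide)) (ne (by decide))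
      (ne (by decide))).rotate.swap.commutator hh inter_subset_left (fun x hx => ht.map_fst _ hx.2)
      (fun x hx hx' => ht.fix _ fun y hy => ?_) (fun x hx => ht.fix _ fun y hy => ?_)
      (fun x hx => ht.fix _ fun y hy => ?_) (fun x hx y hy => ?_) (fun x hx y hy => ?_)
    · simp only [Function.comp, Ne, hw]
      refine ⟨fun h => hx' ⟨hx, ?_⟩, by simp, by simp⟩
      rw [mem_preimage, h.2]; exact hy
    · simp [hw]
    · simp [hw]
    · simp [hw]
    · rw [Function.comp, homeo_inv_apply_eq (ht.map_trd _ hx.2)]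
      simp [hw]
  exact (hH.hasTricycle_move (j := w 4) (l := w 5) h3.rotate (ne (by decide)) (ne (by decide))
    (ne (by decide)) (by simp [hw]) (by simp [hw])).rotate.rotate

lemma realized_of_leftInvOn {g : X → X} (h1 : Realized H e D f) (hg : LeftInvOn g f D) :
    Realized H e (f '' D) g := by
  obtain ⟨w, hwi, hw⟩ := hH.exists_embedding
  have ne : ∀ {i j : Fin 8}, i ≠ j → w i ≠ w j := fun h => hwi.ne h
  have inj : InjOn g (f '' D) := by
    rintro _ ⟨x, hx, rfl⟩ _ ⟨y, hy, rfl⟩ h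
    rw [hg hx, hg hy] at h
    rw [h]
  have h2 := h1.hasTricycle (w 0) (w 1) (w 2) (ne (by decide)) (ne (by decide)) (ne (by decide))
  rw [← hg.image_image] at h2
  have h3 : HasTricycle H (f '' D) (e (w 0) ∘ g) (e (w 1)) (e (w 2)) := by
    refine h2.comp_right.congr (fun _ _ => rfl) ?_ ?_ <;>
    · rintro _ ⟨x, hx, rfl⟩
      simp only [Function.comp, hg hx]
  refine hH.realized_of_hasTricycle inj (ne (i := 1) (j := 0) (by decide))
    (ne (i := 1) (j := 3) (by decide)) (ne (by decide)) ?_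
  exact (hH.hasTricycle_move (j := w 3) (l := w 4) h3 (ne (by decide)) (ne (by decide))
    (ne (by decide)) (by simp [hw]) (by simp [hw])).rotate.rotate

lemma exists_realized_leftInvOn (h1 : Realized H e D f) :
    ∃ g, LeftInvOn g f D ∧ Realized H e (f '' D) g := by
  cases isEmpty_or_nonempty X with
  | inl h => exact ⟨f, fun x => isEmptyElim x, hH.realized_of_leftInvOn h1 fun x => isEmptyElim x⟩
  | inr h => exact ⟨_, h1.injOn.leftInvOn_invFunOn,
      hH.realized_of_leftInvOn h1 h1.injOn.leftInvOn_invFunOn⟩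

lemma realized_id_of_realized (h1 : Realized H e D f) : Realized H e D id := by
  obtain ⟨g, hg, h2⟩ := hH.exists_realized_leftInvOn h1
  have h3 := hH.realized_comp h1 h2
  rw [inter_eq_left.2 (subset_preimage_image f D)] at h3
  exact h3.congr fun x hx => hg hx

lemma realized_inter (h1 : Realized H e D id) (h2 : Realized H e D' f) :
    Realized H e (D ∩ D') f := hH.realized_comp h1 h2

lemma realized_union (h1 : Realized H e D f) (h2 : Realized H e D' f) (hf : InjOn f (D ∪ D')) :
    Realized H e (D ∪ D') f :=
  ⟨hf, fun i j k hij hik hjk => (h1.hasTricycle i j k hij hik hjk).union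
    (h2.hasTricycle i j k hij hik hjk)
    ((hH.realized_inter (hH.realized_id_of_realized h1) h2).hasTricycle i j k hij hik hjk)
    (separated_copies hH.injective hf hij hik hjk)⟩

lemma realized_biUnion {κ : Type*} {s : Finset κ} {D : κ → Set X}
    (h : ∀ k ∈ s, Realized H e (D k) f) (hf : InjOn f (⋃ k ∈ s, D k)) :
    Realized H e (⋃ k ∈ s, D k) f := by
  classical
  induction s using Finset.induction_on with
  | empty => exact ⟨hf, fun i j k _ _ _ => by simpa using HasTricycle.empty H _ _ _⟩
  | insert k s hk ih =>
    rw [Finset.set_biUnion_insert] at hf ⊢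
    exact hH.realized_union (h k (Finset.mem_insert_self k s))
      (ih (fun l hl => h l (Finset.mem_insert_of_mem hl)) (hf.mono subset_union_right)) hf

/-- Conjugation by the alternating group changes the copies in a three-cycle whose first map
avoids all of them. -/
lemma hasTricycle_changeCopies {p' q' : ι} (hg : HasTricycle H D a (e p) (e q))
    (ha : ∀ x ∈ D, ∀ i y, a x ≠ e i y) (hpq : p ≠ q) (hpq' : p' ≠ q') :
    HasTricycle H D a (e p') (e q') := by
  have hc := hH.card
  have fresh : ∀ p q : ι, ∃ r, p ≠ r ∧ q ≠ r := fun p q => by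
    obtain ⟨r, hr⟩ : ∃ r, r ∉ ({p, q} : Finset ι) := by
      by_contra! h
      have h1 := Finset.card_le_card (fun i _ => h i : Finset.univ ⊆ {p, q})
      have h2 := Finset.card_le_two (a := p) (b := q)
      rw [Finset.card_univ] at h1
      omega
    simp only [Finset.mem_insert, Finset.mem_singleton, not_or] at hr
    exact ⟨r, fun h => hr.1 h.symm, fun h => hr.2 h.symm⟩
  obtain ⟨r, hpr, hqr⟩ := fresh p q
  obtain ⟨r', hpr', hqr'⟩ := fresh p' q'
  obtain ⟨σ, hσ, h1, h2, -⟩ := exists_mem_alternatingGroup_map (by omega) hpq hpr hqr hpq' hpr' hqr'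
  obtain ⟨g, hgH, hgσ⟩ := hH.exists_mem σ hσ
  refine (hg.conj hgH).congr (fun x hx => hgσ.fix _ (ha x hx)) (fun x _ => ?_) fun x _ => ?_
  · simp only [Function.comp, hgσ.map, h1]
  · simp only [Function.comp, hgσ.map, h2]

/-- A realized map, followed by the inclusion as the copy `i`, forms a three-cycle with the
inclusions of two other copies. -/
lemma hasTricycle_of_mapsTo_copy (h1 : Realized H e D f) (hij : i ≠ j) (hik : i ≠ k)
    (hjk : j ≠ k) : HasTricycle H D (e i ∘ f) (e j) (e k) := by
  obtain ⟨g, hg, h2⟩ := hH.exists_realized_leftInvOn h1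
  exact (h2.hasTricycle i j k hij hik hjk).comp_right.congr (fun _ _ => rfl)
    (fun x hx => by simp only [Function.comp, hg hx])
    fun x hx => by simp only [Function.comp, hg hx]

/-- The analogue of `hasTricycle_of_mapsTo_copy` for the part `Z` of the space outside the
copies. -/
lemma hasTricycle_of_mapsTo_rest (hZ : ∀ z ∈ Z, ∀ i y, z ≠ e i y) (hpq : p ≠ q)
    (h0 : HasTricycle H Z id (e p) (e q)) (hfZ : MapsTo f D Z) (h1 : Realized H e D f)
    (hij : i ≠ j) : HasTricycle H D f (e i) (e j) := by
  obtain ⟨w, hwi, hw⟩ := hH.exists_embedding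
  have ne : ∀ {i j : Fin 8}, i ≠ j → w i ≠ w j := fun h => hwi.ne h
  obtain ⟨g, hg, h2⟩ := hH.exists_realized_leftInvOn h1
  have h3 : HasTricycle H Z id (e (w 0)) (e (w 1)) :=
    hH.hasTricycle_changeCopies h0 hZ hpq (ne (by decide))
  obtain ⟨h, hh, ht⟩ := h2.hasTricycle (w 0) (w 2) (w 3) (ne (by decide)) (ne (by decide))
    (ne (by decide))
  have hsub : f '' D ⊆ Z := image_subset_iff.2 hfZ
  have h4 : HasTricycle H (f '' D) (e (w 0)) (e (w 2) ∘ g) id := by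
    refine h3.swap.rotate.rotate.commutator hh hsub (fun x hx => ht.map_fst x hx)
      (fun x hx hx' => ht.fix _ fun y hy => ?_)
      (fun x hx => ht.fix _ fun y hy => ⟨hZ _ hx _ _, hZ _ hx _ _, hZ _ hx _ _⟩)
      (fun x hx => ht.fix _ fun y hy => ?_) (fun x hx y hy => ?_) (fun x hx y hy => ?_)
    · simp only [Function.comp, Ne, hw]
      refine ⟨fun h => hx' ?_, by simp, by simp⟩
      rw [h.2]; exact hy
    · simp [hw]
    · exact ⟨by simp [hw], (hZ _ hy _ _).symm, by simp [hw]⟩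
    · rw [homeo_inv_apply_eq (ht.map_trd _ hx)]
      exact ⟨by simp [hw], (hZ _ hy _ _).symm, by simp [hw]⟩
  have h5 := hH.hasTricycle_move (j := w 3) (l := w 4) h4.rotate (ne (by decide)) (ne (by decide))
    (ne (by decide)) (fun x hx y => ⟨hZ _ (hsub hx) _ _, hZ _ (hsub hx) _ _, hZ _ (hsub hx) _ _⟩)
    (by simp [hw])
  have h6 : HasTricycle H D f (e (w 2)) (e (w 3)) := h5.comp_right.rotate.rotate.congr
    (fun _ _ => rfl) (fun x hx => by simp only [Function.comp, hg hx])
    fun x hx => by simp only [Function.comp, hg hx]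
  exact hH.hasTricycle_changeCopies h6 (fun x hx => hZ _ (hfZ hx)) (ne (by decide)) hij

/-- If an element `t` of `H` acts on copies as the three-cycle along `f`, and fixes the points of
two other copies, then `f` is realized, whatever `t` does elsewhere. -/
lemma realized_of_apply {t : X ≃ₜ X} (ht : t ∈ H) (hf : InjOn f D) (hij : i ≠ j) (hik : i ≠ k)
    (hip : i ≠ p) (hiq : i ≠ q) (hjk : j ≠ k) (hjp : j ≠ p) (hjq : j ≠ q) (hkp : k ≠ p)
    (hkq : k ≠ q) (hpq : p ≠ q)
    (h1 : ∀ x ∈ D, t (e i x) = e j (f x)) (h2 : ∀ x ∈ D, t (e k (f x)) = e i x)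
    (h3 : ∀ x ∉ D, t (e i x) = e i x) (h4 : ∀ x, t (e p x) = e p x)
    (h5 : ∀ x, t (e q x) = e q x) : Realized H e D f := by
  have h6 : HasTricycle H D (e i) (e j ∘ f) (e p) := by
    refine (hH.hasTricycle hip hiq hpq).commutator ht (subset_univ _) h1 (fun x _ => h3 x)
      (fun x _ => h4 x) (fun x _ => h5 x) (fun x hx y _ => ?_) (fun x hx y _ => ?_)
    · simp [hH.apply_eq_iff, hij.symm, hjp, hjq]
    · rw [homeo_inv_apply_eq (h2 x hx)]
      simp [hH.apply_eq_iff, hik.symm, hkp, hkq]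
  refine hH.realized_of_hasTricycle hf hij hik hjk ?_
  refine (hH.hasTricycle_move (j := k) (l := q) h6.rotate.swap hjk hjq hkq ?_ ?_).rotate.rotate
  · simp [hH.apply_eq_iff, hij, hik, hiq]
  · simp [hH.apply_eq_iff, hjp.symm, hkp.symm, hpq]

/-- The analogue of `realized_of_apply` for the part `Z` of the space outside the copies. -/
lemma hasTricycle_of_apply {t : X ≃ₜ X} (ht : t ∈ H) (hZ : ∀ z ∈ Z, ∀ i y, z ≠ e i y)
    (hij : i ≠ j) (hip : i ≠ p) (hiq : i ≠ q) (hjp : j ≠ p) (hjq : j ≠ q) (hpq : p ≠ q)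
    (h1 : ∀ x ∈ Z, t x = e i x) (h2 : ∀ x ∈ Z, t (e i x) = e j x)
    (h3 : ∀ x ∉ Z, t (e i x) = e i x) (h4 : ∀ x, t (e p x) = e p x)
    (h5 : ∀ x, t (e q x) = e q x) : HasTricycle H Z id (e p) (e i) := by
  refine ((hH.hasTricycle hip hiq hpq).commutator (H.inv_mem ht) (subset_univ _)
    (fun x hx => homeo_inv_apply_eq (h1 x hx)) (fun x _ hx => homeo_inv_apply_eq (h3 x hx))
    (fun x _ => homeo_inv_apply_eq (h4 x)) (fun x _ => homeo_inv_apply_eq (h5 x))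
    (fun x hx y _ => ⟨hZ x hx _ _, hZ x hx _ _, hZ x hx _ _⟩) (fun x hx y _ => ?_)).rotate
  rw [inv_inv, h2 x hx]
  simp [hH.apply_eq_iff, hij.symm, hjp, hjq]

end ContainsAlternating
end Copies

/-! ### Two generators of an alternating group -/

section Permutations

open Equiv Equiv.Perm

variable {ι : Type*} [Fintype ι] [DecidableEq ι]

/-- If two permutations have a single moved point in common, their commutator is a three-cycle
through this point. -/
lemma commutator_eq_swap_mul_swap {ι : Type*} [DecidableEq ι] {ρ τ : Perm ι} {s : ι}
    (hρ : ρ s ≠ s) (hτ : τ s ≠ s)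
    (h : ∀ x, x ≠ s → ρ x = x ∨ τ x = x) :
    ρ * τ * ρ⁻¹ * τ⁻¹ = swap (τ s) (ρ s) * swap (τ s) s := by
  have h1 : τ (ρ s) = ρ s := (h (ρ s) hρ).resolve_left fun e => hρ (ρ.injective e)
  have h2 : ρ (τ s) = τ s := (h (τ s) hτ).resolve_right fun e => hτ (τ.injective e)
  have h3 : ρ s ≠ τ s := fun e => hτ (τ.injective (by rw [← e, h1]))
  have key : ∀ y, ρ (τ y) = (swap (τ s) (ρ s) * swap (τ s) s) (τ (ρ y)) := by
    intro y
    simp only [Perm.mul_apply]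
    by_cases hy : y = s
    · subst hy
      rw [h1, h2, swap_apply_of_ne_of_ne h3 hρ, swap_apply_right]
    by_cases hr : ρ y = s
    · have hy' : τ y = y := (h y hy).resolve_left fun e => hy (by rw [← e, hr])
      rw [hr, hy', swap_apply_left, swap_apply_of_ne_of_ne hτ.symm hρ.symm, hr]
    by_cases ht : τ y = s
    · have hy' : ρ y = y := (h y hy).resolve_right fun e => hy (by rw [← e, ht])
      rw [hy', ht, swap_apply_right, swap_apply_left]
    rcases h y hy with e | e
    · have e3 : τ y ≠ τ s := fun e => hy (τ.injective e)
      have e2 : ρ (τ y) = τ y := by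
        rcases h _ ht with e' | e'
        · exact e'
        · rw [τ.injective e', e]
      rw [e, e2, swap_apply_of_ne_of_ne e3 ht, swap_apply_of_ne_of_ne e3]
      intro e4
      exact hρ (ρ.injective (by rw [← e4, e2]))
    · have e3 : ρ y ≠ ρ s := fun e => hy (ρ.injective e)
      have e2 : τ (ρ y) = ρ y := by
        rcases h _ hr with e' | e'
        · rw [ρ.injective e', e]
        · exact e'
      have e4 : ρ y ≠ τ s := fun e4 => hτ (τ.injective (by rw [← e4, e2]))
      rw [e, e2, swap_apply_of_ne_of_ne e4 hr, swap_apply_of_ne_of_ne e4 e3]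
  ext y
  have := key (ρ⁻¹ (τ⁻¹ y))
  simpa [Perm.mul_apply] using this

/-- A criterion for two permutations `π` and `ρ` to generate a group containing the alternating
group. The commutator of `ρ` and its conjugate by `π` is a three-cycle, which makes every
nontrivial block through `π r` contain `r`, hence invariant under `π` and `ρ`. The claim then
follows from Jordan's theorem on primitive groups containing a three-cycle. -/
lemma alternatingGroup_le_closure_pair {π ρ : Perm ι} {r : ι} (hr : ρ (π r) = r) (hπ : π r ≠ r)
    (hfix : ∀ x, x ≠ r → ρ x = x ∨ ρ (π x) = π x)
    (hinv : ∀ B : Set ι, r ∈ B → (∀ x, x ∈ B → π x ∈ B) → (∀ x, x ∈ B → ρ x ∈ B) → B = univ) :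
    _root_.alternatingGroup ι ≤ Subgroup.closure {π, ρ} := by
  set K := Subgroup.closure {π, ρ} with hK
  have hπK : π ∈ K := Subgroup.subset_closure (by simp)
  have hρK : ρ ∈ K := Subgroup.subset_closure (by simp)
  set s := π r with hs
  set τ := π * ρ * π⁻¹ with hτ
  have hτs : τ s = π (ρ r) := by simp [hτ, hs]
  have hρr : ρ r ≠ r := fun e => hπ (ρ.injective (by rw [hr, e]))
  have hρs : ρ s ≠ s := by rw [hr]; exact hπ.symm
  have hτs' : τ s ≠ s := by rw [hτs]; exact fun e => hρr (π.injective e)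
  have hdis : ∀ x, x ≠ s → ρ x = x ∨ τ x = x := by
    intro x hx
    have hx' : π⁻¹ x ≠ r := fun e => hx (by rw [hs, ← e]; simp)
    rcases hfix _ hx' with h | h
    · right; simp only [hτ, Perm.mul_apply, h]; simp
    · left; simpa using h
  have hρτ : ρ s ≠ τ s := fun e => by
    have h1 : τ (ρ s) = ρ s := (hdis (ρ s) hρs).resolve_left fun e => hρs (ρ.injective e)
    exact hτs' (τ.injective (by rw [← e, h1]))
  set γ := ρ * τ * ρ⁻¹ * τ⁻¹ with hγ
  have hτK : τ ∈ K := K.mul_mem (K.mul_mem hπK hρK) (K.inv_mem hπK)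
  have hγK : γ ∈ K := K.mul_mem (K.mul_mem (K.mul_mem hρK hτK) (K.inv_mem hρK)) (K.inv_mem hτK)
  have hγe : γ = swap (τ s) (ρ s) * swap (τ s) s := commutator_eq_swap_mul_swap hρs hτs' hdis
  have hγ3 : γ.IsThreeCycle := by
    rw [hγe]; exact isThreeCycle_swap_mul_swap_same hρτ.symm hτs' hρs
  have hγs : γ s = ρ s := by rw [hγe]; simp
  have hγfix : ∀ x, x ≠ s → x ≠ ρ s → x ≠ τ s → γ x = x := fun x h1 h2 h3 => by
    rw [hγe, Perm.mul_apply, swap_apply_of_ne_of_ne h3 h1, swap_apply_of_ne_of_ne h3 h2]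
  refine alternatingGroup_le_of_isPreprimitive_of_isThreeCycle_mem ?_ hγ3 hγK
  refine MulAction.IsPreprimitive.of_isTrivialBlock_of_notMem_fixedPoints (a := s) ?_ ?_
  · intro h
    exact hρs (h ⟨ρ, hρK⟩)
  intro B hsB hB
  -- an element of `K` which does not move a point of the block out of it stabilizes the block
  have stab : ∀ g ∈ K, ∀ x ∈ B, g x ∈ B → ∀ y ∈ B, g y ∈ B := by
    intro g hg x hx hgx y hy
    rcases MulAction.isBlock_iff_smul_eq_or_disjoint.1 hB ⟨g, hg⟩ with h | h
    · rw [← h]; exact Set.smul_mem_smul_set hy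
    · exact absurd hgx (disjoint_left.1 h (Set.smul_mem_smul_set (a := (⟨g, hg⟩ : K)) hx))
  by_cases hsub : B.Subsingleton
  · exact Or.inl hsub
  right
  rw [Set.not_subsingleton_iff] at hsub
  obtain ⟨x, hx, hxs⟩ := hsub.exists_ne s
  have hrB : r ∈ B := by
    rw [← hr, ← hγs]
    by_cases h1 : x = ρ s
    · rw [hγs, ← h1]; exact hx
    by_cases h2 : x = τ s
    · have hγt : γ x = s := by
        rw [h2, hγe, Perm.mul_apply, swap_apply_left,
          swap_apply_of_ne_of_ne hτs'.symm hρs.symm]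
      exact stab γ hγK x hx (by rwa [hγt]) s hsB
    exact stab γ hγK x hx (by rwa [hγfix x hxs h1 h2]) s hsB
  exact hinv B hrB (stab π hπK r hrB hsB) (stab ρ hρK s hsB (by rwa [hr]))

/-- For every `n ≥ 3` there are alternating groups generated by an element of order `n` and a
cycle with many fixed points, of length congruent to one modulo three. -/
theorem exists_generators_alternatingGroup {n : ℕ} (hn : 2 < n) (m : ℕ) :
    ∃ (ι : Type) (_ : Fintype ι) (_ : DecidableEq ι) (π ρ : Perm ι) (F : Finset ι) (k : ℕ),
      m ≤ F.card ∧ (∀ i ∈ F, ρ i = i) ∧ orderOf π = n ∧ π ∈ _root_.alternatingGroup ι ∧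
      ρ ∈ _root_.alternatingGroup ι ∧ ρ ^ (3 * k + 1) = 1 ∧
      _root_.alternatingGroup ι ≤ Subgroup.closure {π, ρ} := by
  have : NeZero n := ⟨by omega⟩
  have : Fact (1 < n) := ⟨by omega⟩
  have h2 : (2 : ZMod n) ≠ 0 := by
    have : ((2 : ℕ) : ZMod n) ≠ 0 := by
      rw [Ne, ZMod.natCast_eq_zero_iff]
      exact fun h => absurd (Nat.le_of_dvd (by norm_num) h) (by omega)
    exact_mod_cast this
  have h12 : (1 : ZMod n) ≠ 2 := fun h => one_ne_zero (α := ZMod n) (by linear_combination -h)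
  -- `π` shifts each row `{i} × ZMod n` cyclically; the cycle `ρ` runs through `(0, 1)` and then
  -- down the column `0`. The length `L + 2` of `ρ` is odd and congruent to one modulo three, and
  -- the number `L + 1` of rows is even.
  let L := 6 * m + 5
  let f : Fin (L + 2) → Fin (L + 1) × ZMod n := Fin.cons (0, 1) fun k => (k, 0)
  have f0 : f 0 = (0, 1) := rfl
  have fs : ∀ k : Fin (L + 1), f k.succ = (k, 0) := fun k => rfl
  have hf : Function.Injective f := by
    rw [Fin.cons_injective_iff]
    refine ⟨?_, fun a b h => (Prod.ext_iff.1 h).1⟩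
    rintro ⟨k, hk⟩
    exact zero_ne_one (Prod.ext_iff.1 hk).2
  have hrange : ∀ x, x ∉ range f → ∀ {e : Perm (Fin (L + 2))}, e.viaEmbedding ⟨f, hf⟩ x = x :=
    fun x hx e => viaEmbedding_apply_of_notMem _ _ _ hx
  have memf : ∀ x, x ∈ range f ↔ x.2 = 0 ∨ x = (0, 1) := by
    intro x
    rw [Fin.range_cons, mem_insert_iff, or_comm]
    refine or_congr ⟨?_, fun h => ⟨x.1, Prod.ext rfl h.symm⟩⟩ Iff.rfl
    rintro ⟨k, rfl⟩; rfl
  let π : Perm (Fin (L + 1) × ZMod n) := Equiv.prodCongrRight fun _ => Equiv.addRight 1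
  let ρ : Perm (Fin (L + 1) × ZMod n) := (finRotate (L + 2)).viaEmbedding ⟨f, hf⟩
  have hπ : ∀ x, π x = (x.1, x.2 + 1) := fun x => rfl
  have hπk : ∀ (k : ℕ) x, (π ^ k) x = (x.1, x.2 + k) := by
    intro k
    induction k with
    | zero => simp
    | succ k ih =>
      intro x
      rw [pow_succ', Perm.mul_apply, ih, hπ]
      simp [add_assoc]
  have hρ : ∀ k, ρ (f k) = f (k + 1) := by
    intro k
    have := viaEmbedding_apply (finRotate (L + 2)) ⟨f, hf⟩ k
    rw [finRotate_apply] at this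
    exact this
  have hρ0 : ρ (0, 1) = (0, 0) := by rw [← f0, hρ, zero_add]; exact fs 0
  refine ⟨Fin (L + 1) × ZMod n, inferInstance, inferInstance, π, ρ,
    Finset.univ.map ⟨fun i => (i, 2), fun a b h => (Prod.ext_iff.1 h).1⟩, 2 * m + 2,
    ?_, ?_, ?_, ?_, ?_, ?_, ?_⟩
  · simp [L]; omega
  · intro i hi
    simp only [Finset.mem_map, Finset.mem_univ, true_and] at hi
    obtain ⟨j, rfl⟩ := hi
    refine hrange _ fun h => ?_
    rcases (memf _).1 h with h | h
    · exact h2 h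
    · exact h12 (Prod.ext_iff.1 h).2.symm
  · have : ∀ k : ℕ, π ^ k = 1 ↔ n ∣ k := by
      intro k
      rw [← ZMod.natCast_eq_zero_iff]
      refine ⟨fun h => ?_, fun h => ?_⟩
      · have := hπk k (0, 0)
        rw [h] at this
        simpa using (Prod.ext_iff.1 this).2.symm
      · ext1 x
        rw [hπk, h]; simp
    refine Nat.dvd_antisymm (orderOf_dvd_of_pow_eq_one ((this n).2 dvd_rfl)) ?_
    exact (this _).1 (pow_orderOf_eq_one π)
  · rw [mem_alternatingGroup, sign_prodCongrRight, Finset.prod_const, Finset.card_univ,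
      Fintype.card_fin]
    have : L + 1 = 2 * (3 * m + 3) := by simp [L]; ring
    rw [this, pow_mul, Int.units_sq, one_pow]
  · have e : ρ = (finRotate (L + 2)).viaFintypeEmbedding ⟨f, hf⟩ := by
      ext1 x
      by_cases hx : x ∈ range f
      · obtain ⟨k, rfl⟩ := hx
        exact (viaEmbedding_apply _ ⟨f, hf⟩ k).trans
          (viaFintypeEmbedding_apply_image _ ⟨f, hf⟩ k).symm
      · rw [viaFintypeEmbedding_apply_notMem_range _ _ hx]
        exact hrange x hx
    rw [mem_alternatingGroup, e, viaFintypeEmbedding_sign, sign_finRotate]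
    have : L + 2 - 1 = 2 * (3 * m + 3) := by simp [L]; omega
    rw [this, pow_mul, Int.units_sq, one_pow]
  · have e : ρ = viaEmbeddingHom ⟨f, hf⟩ (finRotate (L + 2)) := rfl
    have e' : 3 * (2 * m + 2) + 1 = L + 2 := by simp [L]; omega
    have : orderOf (finRotate (L + 2)) = L + 2 := by
      rw [isCycle_finRotate.orderOf, support_finRotate, Finset.card_univ, Fintype.card_fin]
    have h1 : finRotate (L + 2) ^ (L + 2) = 1 := by
      have := pow_orderOf_eq_one (finRotate (L + 2))
      rwa [‹orderOf _ = _›] at this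
    rw [e, e', ← map_pow, h1, map_one]
  · have hπ0 : π (0, 0) = (0, 1) := by rw [hπ]; simp
    refine alternatingGroup_le_closure_pair (r := (0, 0)) ?_ ?_ ?_ ?_
    · rw [hπ0, hρ0]
    · rw [hπ0]; exact fun h => one_ne_zero (Prod.ext_iff.1 h).2
    · intro x hx
      by_contra! hcon
      have h3 : x ∈ range f := by by_contra h; exact hcon.1 (hrange x h)
      have h4 : π x ∈ range f := by by_contra h; exact hcon.2 (hrange _ h)
      rw [memf] at h3 h4
      rw [hπ] at h4
      rcases h3 with h3 | h3
      · rcases h4 with h4 | h4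
        · rw [h3] at h4; simp at h4
        · exact hx (Prod.ext (Prod.ext_iff.1 h4).1 h3)
      · rw [h3] at h4
        rcases h4 with h4 | h4
        · exact h2 (by simp only at h4; linear_combination h4)
        · have := (Prod.ext_iff.1 h4).2
          simp at this
    · intro B h0 hBπ hBρ
      have hrow : ∀ (i : Fin (L + 1)), (i, 0) ∈ B := by
        intro i
        induction i using Fin.induction with
        | zero => exact h0
        | succ i ih =>
          have := hBρ _ ih
          rw [← fs, hρ, ← Fin.castSucc_succ, Fin.coeSucc_eq_succ] at this
          exact this
      rw [eq_univ_iff_forall]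
      rintro ⟨i, j⟩
      have : ∀ k : ℕ, (π ^ k) (i, 0) ∈ B := by
        intro k
        induction k with
        | zero => simpa using hrow i
        | succ k ih => rw [pow_succ', Perm.mul_apply]; exact hBπ _ ih
      have := this j.val
      rw [hπk] at this
      simpa using this

end Permutations

/-! ### Sources and ranges -/

section SourceRange

variable {G : Type*} [ArrowGroupoid G]

lemma composable_of_src_eq_rng {a b : G} (h : src a = rng b) : Composable a b := by
  have h' : a⁻¹ * a = b * b⁻¹ := congrArg Subtype.val h
  have h1 : a * (a⁻¹ * a) = a := by
    rw [← assoc _ _ _ (composable_inv_right a) (composable_inv_left a)]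
    have := mul_mul_inv a a⁻¹ (composable_inv_right a)
    rwa [inv_invol] at this
  have h2 : Composable a (a⁻¹ * a) :=
    composable_mul_right _ _ _ (composable_inv_right a) (composable_inv_left a)
  have h3 : Composable (a⁻¹ * a) b := by
    rw [h']
    exact composable_mul_left _ _ _ (composable_inv_right b) (composable_inv_left b)
  have := composable_mul_left _ _ _ h2 h3
  rwa [h1] at this

lemma Composable.src_eq_rng {a b : G} (h : Composable a b) : src a = rng b := by
  apply Subtype.ext
  change a⁻¹ * a = b * b⁻¹
  have h1 := composable_mul_right _ _ _ (composable_inv_left a) h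
  have h2 := composable_mul_left _ _ _ h (composable_inv_right b)
  calc a⁻¹ * a = a⁻¹ * ((a * b) * b⁻¹) := by rw [mul_mul_inv a b h]
    _ = (a⁻¹ * (a * b)) * b⁻¹ := (assoc _ _ _ h1 h2).symm
    _ = b * b⁻¹ := by rw [inv_mul_mul a b h]

lemma src_inv (a : G) : src a⁻¹ = rng a := Subtype.ext (by simp [src, rng, inv_invol])

lemma rng_inv (a : G) : rng a⁻¹ = src a := Subtype.ext (by simp [src, rng, inv_invol])

lemma src_mul {a b : G} (h : Composable a b) : src (a * b) = src b := by
  rw [← rng_inv b]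
  exact Composable.src_eq_rng (composable_mul_left _ _ _ h (composable_inv_right b))

lemma rng_mul {a b : G} (h : Composable a b) : rng (a * b) = rng a := by
  rw [← src_inv a]
  exact (Composable.src_eq_rng (composable_mul_right _ _ _ (composable_inv_left a) h)).symm

lemma src_coe (x : unitSpace G) : src (x : G) = x := by
  obtain ⟨_, a, rfl⟩ := x
  exact (src_mul (composable_inv_right a)).trans (src_inv a)

lemma rng_coe (x : unitSpace G) : rng (x : G) = x := by
  obtain ⟨_, a, rfl⟩ := x
  exact rng_mul (composable_inv_right a)

end SourceRange

/-! ### Partial homeomorphisms of the unit space given by bisections -/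

section LocalMaps

variable {G : Type*} [TopologicalSpace G] [TopologicalGroupoid G]

lemma continuous_src : Continuous (src : G → unitSpace G) := by
  refine Continuous.subtype_mk ?_ _
  have h : ContinuousOn (fun p : G × G => p.1 * p.2) {p : G × G | Composable p.1 p.2} :=
    continuousOn_mul
  exact h.comp_continuous (continuous_inv.prodMk continuous_id) fun a => composable_inv_left a

lemma continuous_rng : Continuous (rng : G → unitSpace G) := by
  have : (rng : G → unitSpace G) = fun a => src a⁻¹ := funext fun a => (src_inv a).symm
  rw [this]
  exact continuous_src.comp continuous_inv

lemma IsBisection.injOn_src {B : Set G} (hB : IsBisection B) : InjOn src B :=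
  injOn_iff_injective.2 hB.2.1.injective

lemma IsBisection.injOn_rng {B : Set G} (hB : IsBisection B) : InjOn rng B :=
  injOn_iff_injective.2 hB.2.2.injective

lemma IsBisection.isOpen_image_rng {B C : Set G} (hB : IsBisection B) (hC : IsOpen C)
    (hCB : C ⊆ B) : IsOpen (rng '' C) := by
  have h := hB.2.2.isOpenMap _ (hC.preimage continuous_subtype_val)
  convert h using 1
  ext y
  constructor
  · rintro ⟨b, hb, rfl⟩
    exact ⟨⟨b, hCB hb⟩, hb, rfl⟩
  · rintro ⟨⟨b, hb⟩, hb', rfl⟩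
    exact ⟨b, hb', rfl⟩

lemma IsBisection.isOpen_image_src {B C : Set G} (hB : IsBisection B) (hC : IsOpen C)
    (hCB : C ⊆ B) : IsOpen (src '' C) := by
  have h := hB.2.1.isOpenMap _ (hC.preimage continuous_subtype_val)
  convert h using 1
  ext y
  constructor
  · rintro ⟨b, hb, rfl⟩
    exact ⟨⟨b, hCB hb⟩, hb, rfl⟩
  · rintro ⟨⟨b, hb⟩, hb', rfl⟩
    exact ⟨b, hb', rfl⟩

/-- Every bisection acts on the unit space by a map, which is unique on the source. -/
lemma IsBisection.exists_map {B : Set G} (hB : IsBisection B) :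
    ∃ f : unitSpace G → unitSpace G, ∀ b ∈ B, f (src b) = rng b := by
  have h : ∀ x : unitSpace G, ∃ y, ∀ b ∈ B, src b = x → y = rng b := by
    intro x
    by_cases hx : x ∈ src '' B
    · obtain ⟨b, hb, rfl⟩ := hx
      exact ⟨rng b, fun b' hb' h => by rw [hB.injOn_src hb' hb h]⟩
    · exact ⟨x, fun b hb h => absurd ⟨b, hb, h⟩ hx⟩
  choose f hf using h
  exact ⟨f, fun b hb => hf _ b hb rfl⟩

/-- The map `f` restricts to an injective map on the clopen set `D` that is given by the arrows of
the groupoid: there is a continuous choice of arrows from `x` to `f x`, for `x ∈ D`. Equivalently,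
`f` is on `D` the action `s(b) ↦ r(b)` of a compact open bisection with source `D`. -/
structure IsLocal (D : Set (unitSpace G)) (f : unitSpace G → unitSpace G) : Prop where
  isClopen : IsClopen D
  injOn : InjOn f D
  exists_section : ∃ γ : unitSpace G → G, ContinuousOn γ D ∧
    ∀ x ∈ D, src (γ x) = x ∧ rng (γ x) = f x

namespace IsLocal

variable {D D' : Set (unitSpace G)} {f f' g : unitSpace G → unitSpace G}

lemma id (hD : IsClopen D) : IsLocal D id :=
  ⟨hD, injOn_id D, Subtype.val, continuous_subtype_val.continuousOn,
    fun x _ => ⟨src_coe x, rng_coe x⟩⟩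

lemma congr (hf : IsLocal D f) (h : EqOn f f' D) : IsLocal D f' :=
  let ⟨h1, h2, γ, h3, h4⟩ := hf
  ⟨h1, h2.congr h, γ, h3, fun x hx => ⟨(h4 x hx).1, by rw [(h4 x hx).2, h hx]⟩⟩

lemma mono (hf : IsLocal D f) (hD' : IsClopen D') (h : D' ⊆ D) : IsLocal D' f :=
  let ⟨_, h2, γ, h3, h4⟩ := hf
  ⟨hD', h2.mono h, γ, h3.mono h, fun x hx => h4 x (h hx)⟩

lemma continuousOn (hf : IsLocal D f) : ContinuousOn f D := by
  obtain ⟨_, _, γ, h3, h4⟩ := hf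
  exact (continuous_rng.comp_continuousOn h3).congr fun x hx => (h4 x hx).2.symm

lemma comp (hf : IsLocal D f) (hf' : IsLocal D' f') (h : MapsTo f D D') :
    IsLocal D (f' ∘ f) := by
  have hc := hf.continuousOn
  obtain ⟨h1, h2, γ, h3, h4⟩ := hf
  obtain ⟨_, h2', γ', h3', h4'⟩ := hf'
  have hcomp : ∀ x ∈ D, Composable (γ' (f x)) (γ x) := fun x hx =>
    composable_of_src_eq_rng (by rw [(h4' _ (h hx)).1, (h4 x hx).2])
  have hm : ContinuousOn (fun p : G × G => p.1 * p.2) {p : G × G | Composable p.1 p.2} :=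
    continuousOn_mul
  refine ⟨h1, h2'.comp h2 h, fun x => γ' (f x) * γ x,
    hm.comp ((h3'.comp hc h).prodMk h3) hcomp, fun x hx => ⟨?_, ?_⟩⟩
  · rw [src_mul (hcomp x hx), (h4 x hx).1]
  · rw [rng_mul (hcomp x hx), (h4' _ (h hx)).2]; rfl

lemma union (hf : IsLocal D f) (hf' : IsLocal D' f) (hD : Disjoint D D')
    (hi : InjOn f (D ∪ D')) : IsLocal (D ∪ D') f := by
  classical
  obtain ⟨h1, h2, γ, h3, h4⟩ := hf
  obtain ⟨h1', h2', γ', h3', h4'⟩ := hf'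
  have e1 : EqOn (D.piecewise γ γ') γ D := fun x hx => piecewise_eq_of_mem _ _ _ hx
  have e2 : EqOn (D.piecewise γ γ') γ' D' := fun x hx =>
    piecewise_eq_of_notMem _ _ _ (disjoint_right.1 hD hx)
  refine ⟨h1.union h1', hi, D.piecewise γ γ',
    (h3.congr e1).union_of_isOpen (h3'.congr e2) h1.isOpen h1'.isOpen, ?_⟩
  rintro x (hx | hx)
  · rw [e1 hx]; exact h4 x hx
  · rw [e2 hx]; exact h4' x hx

lemma isOpen_image (hample : IsAmple G) (hf : IsLocal D f) {V : Set (unitSpace G)}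
    (hV : IsOpen V) (hVD : V ⊆ D) : IsOpen (f '' V) := by
  obtain ⟨h1, h2, γ, h3, h4⟩ := hf
  rw [isOpen_iff_forall_mem_open]
  rintro _ ⟨x, hx, rfl⟩
  obtain ⟨C, hC, hxC, -⟩ := hample.exists_subset_of_mem_open (mem_univ (γ x)) isOpen_univ
  have hW : IsOpen (V ∩ γ ⁻¹' C) := (h3.mono hVD).isOpen_inter_preimage hV hC.2.1
  refine ⟨f '' (V ∩ γ ⁻¹' C), image_mono inter_subset_left, ?_, mem_image_of_mem f ⟨hx, hxC⟩⟩
  have := hC.2.isOpen_image_rng (hC.2.1.inter (hW.preimage continuous_src)) inter_subset_left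
  convert this using 1
  ext y
  constructor
  · rintro ⟨z, ⟨hz, hzC⟩, rfl⟩
    exact ⟨γ z, ⟨hzC, by rw [mem_preimage, (h4 z (hVD hz)).1]; exact ⟨hz, hzC⟩⟩,
      (h4 z (hVD hz)).2⟩
  · rintro ⟨b, ⟨hb, hb'⟩, rfl⟩
    have e : γ (src b) = b := hC.2.injOn_src hb'.2 hb (h4 _ (hVD hb'.1)).1
    exact ⟨src b, hb', by rw [← (h4 _ (hVD hb'.1)).2, e]⟩

variable [CompactSpace (unitSpace G)] [T2Space (unitSpace G)]

lemma isClopen_image (hample : IsAmple G) (hf : IsLocal D f) : IsClopen (f '' D) :=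
  ⟨(hf.isClopen.isClosed.isCompact.image_of_continuousOn hf.continuousOn).isClosed,
    hf.isOpen_image hample hf.isClopen.isOpen subset_rfl⟩

lemma leftInvOn (hample : IsAmple G) (hf : IsLocal D f) (hg : LeftInvOn g f D) :
    IsLocal (f '' D) g := by
  have hc : ContinuousOn g (f '' D) := by
    rw [continuousOn_open_iff (hf.isOpen_image hample hf.isClopen.isOpen subset_rfl)]
    intro V hV
    convert hf.isOpen_image hample (hf.isClopen.isOpen.inter hV) inter_subset_left using 1
    ext y
    constructor
    · rintro ⟨⟨x, hx, rfl⟩, hy⟩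
      rw [mem_preimage, hg hx] at hy
      exact ⟨x, ⟨hx, hy⟩, rfl⟩
    · rintro ⟨x, ⟨hx, hxV⟩, rfl⟩
      exact ⟨⟨x, hx, rfl⟩, by rwa [mem_preimage, hg hx]⟩
  have hcl := hf.isClopen_image hample
  obtain ⟨h1, h2, γ, h3, h4⟩ := hf
  refine ⟨hcl, ?_, fun y => (γ (g y))⁻¹, continuous_inv.comp_continuousOn (h3.comp hc ?_), ?_⟩
  · rintro _ ⟨x, hx, rfl⟩ _ ⟨y, hy, rfl⟩ h
    rw [hg hx, hg hy] at h
    rw [h]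
  · rintro _ ⟨x, hx, rfl⟩
    rwa [hg hx]
  · rintro _ ⟨x, hx, rfl⟩
    simp only [hg hx, src_inv, rng_inv]
    exact (h4 x hx).symm

lemma exists_leftInvOn (hample : IsAmple G) (hf : IsLocal D f) :
    ∃ g, LeftInvOn g f D ∧ IsLocal (f '' D) g := by
  cases isEmpty_or_nonempty (unitSpace G) with
  | inl h => exact ⟨f, fun x => isEmptyElim x, hf.leftInvOn hample fun x => isEmptyElim x⟩
  | inr h => exact ⟨_, hf.injOn.leftInvOn_invFunOn,
      hf.leftInvOn hample hf.injOn.leftInvOn_invFunOn⟩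

omit [CompactSpace (unitSpace G)] in
lemma of_bisection {B : Set G} (hB : IsCompactBisection B)
    (hf : ∀ b ∈ B, f (src b) = rng b) : IsLocal (src '' B) f := by
  have hγ : ∀ x : unitSpace G, ∃ b : G, x ∈ src '' B → b ∈ B ∧ src b = x := by
    intro x
    by_cases hx : x ∈ src '' B
    · obtain ⟨b, hb, rfl⟩ := hx
      exact ⟨b, fun _ => ⟨hb, rfl⟩⟩
    · exact ⟨x, fun h => absurd h hx⟩
  choose γ hγ using hγ
  have hγs : ∀ b ∈ B, γ (src b) = b := fun b hb =>
    have h := hγ (src b) (mem_image_of_mem _ hb)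
    hB.2.injOn_src h.1 hb h.2
  have hopen : IsOpen (src '' B) := hB.2.isOpen_image_src hB.2.1 subset_rfl
  refine ⟨⟨(hB.1.image continuous_src).isClosed, hopen⟩, ?_, γ, ?_, ?_⟩
  · rintro _ ⟨a, ha, rfl⟩ _ ⟨b, hb, rfl⟩ h
    rw [hf a ha, hf b hb] at h
    rw [hB.2.injOn_rng ha hb h]
  · rw [continuousOn_open_iff hopen]
    intro V hV
    convert hB.2.isOpen_image_src (hB.2.1.inter hV) inter_subset_left using 1
    ext y
    constructor
    · rintro ⟨⟨b, hb, rfl⟩, hy⟩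
      rw [mem_preimage, hγs b hb] at hy
      exact ⟨b, ⟨hb, hy⟩, rfl⟩
    · rintro ⟨b, ⟨hb, hbV⟩, rfl⟩
      exact ⟨⟨b, hb, rfl⟩, by rwa [mem_preimage, hγs b hb]⟩
  · rintro _ ⟨b, hb, rfl⟩
    rw [hγs b hb]
    exact ⟨rfl, (hf b hb).symm⟩

lemma exists_bisection (hample : IsAmple G) (hf : IsLocal D f) :
    ∃ B : Set G, IsCompactBisection B ∧ src '' B = D ∧ rng '' B = f '' D ∧
      ∀ b ∈ B, f (src b) = rng b := by
  have hrange := (hf.isClopen_image hample).isOpen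
  obtain ⟨h1, h2, γ, h3, h4⟩ := hf
  have hsrc : src '' (γ '' D) = D := by
    rw [image_image]
    exact (image_congr fun x hx => (h4 x hx).1).trans (image_id' D)
  have hrng : rng '' (γ '' D) = f '' D := by
    rw [image_image]
    exact image_congr fun x hx => (h4 x hx).2
  have hcpt : IsCompact (γ '' D) := h1.isClosed.isCompact.image_of_continuousOn h3
  have hopen : IsOpen (γ '' D) := by
    rw [isOpen_iff_forall_mem_open]
    rintro _ ⟨x, hx, rfl⟩
    obtain ⟨C, hC, hxC, -⟩ := hample.exists_subset_of_mem_open (mem_univ (γ x)) isOpen_univ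
    have hW : IsOpen (D ∩ γ ⁻¹' C) := h3.isOpen_inter_preimage h1.isOpen hC.2.1
    refine ⟨C ∩ src ⁻¹' (D ∩ γ ⁻¹' C), ?_, hC.2.1.inter (hW.preimage continuous_src),
      hxC, by rw [mem_preimage, (h4 x hx).1]; exact ⟨hx, hxC⟩⟩
    rintro b ⟨hb, hb'⟩
    exact ⟨src b, hb'.1, hC.2.injOn_src hb'.2 hb (h4 _ hb'.1).1⟩
  have hact : ∀ b ∈ γ '' D, f (src b) = rng b := by
    rintro _ ⟨x, hx, rfl⟩
    rw [(h4 x hx).1, (h4 x hx).2]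
  have key : ∀ φ : G → unitSpace G, Continuous φ → InjOn φ (γ '' D) → IsOpen (φ '' (γ '' D)) →
      IsOpenEmbedding ((γ '' D).domRestrict φ) := by
    intro φ hφ hinj ho
    have : CompactSpace (γ '' D) := isCompact_iff_compactSpace.1 hcpt
    have hcont : Continuous ((γ '' D).domRestrict φ) := hφ.comp continuous_subtype_val
    refine ⟨(hcont.isClosedEmbedding (injOn_iff_injective.1 hinj)).isEmbedding, ?_⟩
    rwa [range_domRestrict]
  refine ⟨γ '' D, ⟨hcpt, hopen, key src continuous_src ?_ (by rw [hsrc]; exact h1.isOpen),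
    key rng continuous_rng ?_ (by rwa [hrng])⟩, hsrc, hrng, hact⟩
  · rintro _ ⟨x, hx, rfl⟩ _ ⟨y, hy, rfl⟩ h
    rw [(h4 x hx).1, (h4 y hy).1] at h
    rw [h]
  · rintro _ ⟨x, hx, rfl⟩ _ ⟨y, hy, rfl⟩ h
    rw [(h4 x hx).2, (h4 y hy).2] at h
    rw [h2 hx hy h]

end IsLocal

/-- A bijection of the unit space which is given by the arrows belongs to the topological full
group. -/
lemma exists_mem_topologicalFullGroup [CompactSpace (unitSpace G)] [T2Space (unitSpace G)]
    (hample : IsAmple G) {f g : unitSpace G → unitSpace G} (hf : IsLocal univ f)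
    (hgf : Function.LeftInverse g f) (hfg : Function.RightInverse g f) :
    ∃ h ∈ topologicalFullGroup G, ∀ x, h x = f x := by
  have hg := (hf.leftInvOn hample (fun x _ => hgf x)).continuousOn
  rw [image_univ, hfg.surjective.range_eq, continuousOn_univ] at hg
  refine ⟨⟨⟨f, g, hgf, hfg⟩, continuousOn_univ.1 hf.continuousOn, hg⟩, ?_, fun _ => rfl⟩
  obtain ⟨B, hB, hs, hr, hact⟩ := hf.exists_bisection hample
  rw [image_univ, hfg.surjective.range_eq] at hr
  exact ⟨B, hB, by rw [hs, hr], hact, by rw [hs]; exact fun x hx => absurd trivial hx⟩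

lemma isLocal_of_mem_topologicalFullGroup [CompactSpace (unitSpace G)] [T2Space (unitSpace G)]
    {g : unitSpace G ≃ₜ unitSpace G} (hg : g ∈ topologicalFullGroup G) : IsLocal univ g := by
  obtain ⟨B, hB, -, h2, h3⟩ := hg
  have h := IsLocal.of_bisection hB h2
  have h' : IsLocal (src '' B)ᶜ g := (IsLocal.id h.isClopen.compl).congr fun x hx => (h3 x hx).symm
  have := h.union h' disjoint_compl_right g.injective.injOn
  rwa [union_compl_self] at this

/-- Three-cycles along separated maps that are given by the arrows belong to the alternating
group. -/
lemma hasTricycle_alternatingGroup [CompactSpace (unitSpace G)] [T2Space (unitSpace G)]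
    (hample : IsAmple G) {D : Set (unitSpace G)} {a b c : unitSpace G → unitSpace G}
    (ha : IsLocal D a) (hb : IsLocal D b) (hc : IsLocal D c) (hs : Separated D a b c) :
    HasTricycle (alternatingGroup G) D a b c := by
  classical
  rcases D.eq_empty_or_nonempty with rfl | ⟨x₀, hx₀⟩
  · exact HasTricycle.empty _ _ _ _
  obtain ⟨a', ha', hal⟩ := ha.exists_leftInvOn hample
  obtain ⟨b', hb', hbl⟩ := hb.exists_leftInvOn hample
  obtain ⟨c', hc', hcl⟩ := hc.exists_leftInvOn hample
  have hab : Disjoint (a '' D) (b '' D) := by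
    rw [disjoint_left]; rintro _ ⟨x, hx, rfl⟩ ⟨y, hy, h⟩; exact hs.fst_ne_snd x hx y hy h.symm
  have hbc : Disjoint (b '' D) (c '' D) := by
    rw [disjoint_left]; rintro _ ⟨x, hx, rfl⟩ ⟨y, hy, h⟩; exact hs.snd_ne_trd x hx y hy h.symm
  have hac : Disjoint (a '' D) (c '' D) := by
    rw [disjoint_left]; rintro _ ⟨x, hx, rfl⟩ ⟨y, hy, h⟩; exact hs.trd_ne_fst y hy x hx h
  let F : unitSpace G → unitSpace G := fun y => if y ∈ a '' D then b (a' y) else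
    if y ∈ b '' D then c (b' y) else if y ∈ c '' D then a (c' y) else y
  have Fa : ∀ x ∈ D, F (a x) = b x := fun x hx => by
    simp only [F, if_pos (mem_image_of_mem a hx), ha' hx]
  have Fb : ∀ x ∈ D, F (b x) = c x := fun x hx => by
    have h := mem_image_of_mem b hx
    simp only [F, if_neg (disjoint_right.1 hab h), if_pos h, hb' hx]
  have Fc : ∀ x ∈ D, F (c x) = a x := fun x hx => by
    have h := mem_image_of_mem c hx
    simp only [F, if_neg (disjoint_right.1 hac h), if_neg (disjoint_right.1 hbc h), if_pos h,
      hc' hx]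
  have Ff : ∀ y, y ∉ a '' D → y ∉ b '' D → y ∉ c '' D → F y = y := fun y h1 h2 h3 => by
    simp only [F, if_neg h1, if_neg h2, if_neg h3]
  have F3 : ∀ y, F (F (F y)) = y := by
    intro y
    by_cases h1 : y ∈ a '' D
    · obtain ⟨x, hx, rfl⟩ := h1
      rw [Fa x hx, Fb x hx, Fc x hx]
    by_cases h2 : y ∈ b '' D
    · obtain ⟨x, hx, rfl⟩ := h2
      rw [Fb x hx, Fc x hx, Fa x hx]
    by_cases h3 : y ∈ c '' D
    · obtain ⟨x, hx, rfl⟩ := h3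
      rw [Fc x hx, Fa x hx, Fb x hx]
    rw [Ff y h1 h2 h3, Ff y h1 h2 h3, Ff y h1 h2 h3]
  have Finj : Function.Injective F := fun x y h => by rw [← F3 x, h, F3]
  have la : IsLocal (a '' D) F := by
    refine (hal.comp hb ?_).congr ?_
    · rintro _ ⟨x, hx, rfl⟩; rwa [ha' hx]
    · rintro _ ⟨x, hx, rfl⟩; rw [Function.comp, ha' hx, Fa x hx]
  have lb : IsLocal (b '' D) F := by
    refine (hbl.comp hc ?_).congr ?_
    · rintro _ ⟨x, hx, rfl⟩; rwa [hb' hx]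
    · rintro _ ⟨x, hx, rfl⟩; rw [Function.comp, hb' hx, Fb x hx]
  have lc : IsLocal (c '' D) F := by
    refine (hcl.comp ha ?_).congr ?_
    · rintro _ ⟨x, hx, rfl⟩; rwa [hc' hx]
    · rintro _ ⟨x, hx, rfl⟩; rw [Function.comp, hc' hx, Fc x hx]
  have labc := (la.union lb hab Finj.injOn).union lc (hac.union_left hbc) Finj.injOn
  have lrest : IsLocal (a '' D ∪ b '' D ∪ c '' D)ᶜ F :=
    (IsLocal.id labc.isClopen.compl).congr fun y hy => by
      simp only [mem_compl_iff, mem_union, not_or] at hy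
      exact (Ff y hy.1.1 hy.1.2 hy.2).symm
  have lF := labc.union lrest disjoint_compl_right Finj.injOn
  rw [union_compl_self] at lF
  obtain ⟨g, hg, hgF⟩ := exists_mem_topologicalFullGroup hample lF (g := F ∘ F) F3 F3
  have hgt : IsTricycle g D a b c := by
    refine ⟨fun x hx => (hgF _).trans (Fa x hx), fun x hx => (hgF _).trans (Fb x hx),
      fun x hx => (hgF _).trans (Fc x hx), fun y hy => (hgF y).trans (Ff y ?_ ?_ ?_)⟩
    · rintro ⟨x, hx, h⟩; exact (hy x hx).1 h.symm
    · rintro ⟨x, hx, h⟩; exact (hy x hx).2.1 h.symm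
    · rintro ⟨x, hx, h⟩; exact (hy x hx).2.2 h.symm
  refine ⟨g, Subgroup.subset_closure ⟨hg, ?_, ![a '' D, b '' D, c '' D], ?_, ?_, ?_, ?_⟩, hgt⟩
  · have : Fact (Nat.Prime 3) := ⟨Nat.prime_three⟩
    refine orderOf_eq_prime ?_ fun h => ?_
    · ext1 y
      simp only [pow_succ, pow_zero, one_mul, Homeomorph.mul_apply, hgF, F3, Homeomorph.one_apply]
    · have := hgt.map_fst x₀ hx₀
      rw [h, Homeomorph.one_apply] at this
      exact hs.fst_ne_snd x₀ hx₀ x₀ hx₀ this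
  · have hco : ∀ {S : Set (unitSpace G)}, IsClopen S → IsCompact S ∧ IsOpen S := fun h =>
      ⟨h.isClosed.isCompact, h.isOpen⟩
    intro j
    fin_cases j
    · exact hco la.isClopen
    · exact hco lb.isClopen
    · exact hco lc.isClopen
  · intro i j hij
    fin_cases i <;> fin_cases j <;> first | exact absurd rfl hij | skip
    · exact hab
    · exact hac
    · exact hab.symm
    · exact hbc
    · exact hac.symm
    · exact hbc.symm
  · intro j
    fin_cases j
    · change g '' (a '' D) = b '' D
      rw [image_image]; exact image_congr hgt.map_fst
    · change g '' (b '' D) = c '' D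
      rw [image_image]; exact image_congr hgt.map_snd
    · change g '' (c '' D) = a '' D
      rw [image_image]; exact image_congr hgt.map_trd
  · intro y hy
    simp only [mem_iUnion, not_exists] at hy
    exact (hgF y).trans (Ff y (hy 0) (hy 1) (hy 2))

end LocalMaps

/-! ### Products of three-cycles with disjoint supports -/

section Families

variable {X : Type*} [TopologicalSpace X]

/-- The set of points moved by a three-cycle. -/
def tricycleSupport (D : Set X) (a b c : X → X) : Set X := a '' D ∪ b '' D ∪ c '' D

lemma IsTricycle.apply_of_notMem {g : X ≃ₜ X} {D : Set X} {a b c : X → X}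
    (hg : IsTricycle g D a b c) {y : X} (hy : y ∉ tricycleSupport D a b c) : g y = y := by
  refine hg.fix y fun x hx => ⟨?_, ?_, ?_⟩ <;> rintro rfl
  · exact hy (Or.inl (Or.inl (mem_image_of_mem _ hx)))
  · exact hy (Or.inl (Or.inr (mem_image_of_mem _ hx)))
  · exact hy (Or.inr (mem_image_of_mem _ hx))

lemma exists_mem_forall_apply_eq {κ : Type*} {Γ : Subgroup (X ≃ₜ X)} {D : κ → Set X}
    {a b c : κ → X → X} (s : Finset κ) (h : ∀ k ∈ s, HasTricycle Γ (D k) (a k) (b k) (c k))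
    (hd : ∀ k l, k ≠ l → Disjoint (tricycleSupport (D k) (a k) (b k) (c k))
      (tricycleSupport (D l) (a l) (b l) (c l))) :
    ∃ t ∈ Γ, (∀ k ∈ s, ∀ x ∈ D k, t (a k x) = b k x ∧ t (b k x) = c k x ∧ t (c k x) = a k x) ∧
      ∀ y, (∀ k ∈ s, y ∉ tricycleSupport (D k) (a k) (b k) (c k)) → t y = y := by
  classical
  induction s using Finset.induction_on with
  | empty => exact ⟨1, Γ.one_mem, by simp, fun _ _ => rfl⟩
  | insert k s hk ih =>
    obtain ⟨t, ht, h1, h2⟩ := ih fun l hl => h l (Finset.mem_insert_of_mem hl)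
    obtain ⟨g, hg, hgt⟩ := h k (Finset.mem_insert_self k s)
    have ha : ∀ l, ∀ x ∈ D l, a l x ∈ tricycleSupport (D l) (a l) (b l) (c l) :=
      fun l x hx => Or.inl (Or.inl (mem_image_of_mem _ hx))
    have hb : ∀ l, ∀ x ∈ D l, b l x ∈ tricycleSupport (D l) (a l) (b l) (c l) :=
      fun l x hx => Or.inl (Or.inr (mem_image_of_mem _ hx))
    have hc : ∀ l, ∀ x ∈ D l, c l x ∈ tricycleSupport (D l) (a l) (b l) (c l) :=
      fun l x hx => Or.inr (mem_image_of_mem _ hx)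
    have htk : ∀ y ∈ tricycleSupport (D k) (a k) (b k) (c k), t y = y := fun y hy =>
      h2 y fun l hl => disjoint_left.1 (hd k l fun e => hk (e ▸ hl)) hy
    have hgl : ∀ l ∈ s, ∀ y ∈ tricycleSupport (D l) (a l) (b l) (c l), g y = y := fun l hl y hy =>
      hgt.apply_of_notMem (disjoint_left.1 (hd l k fun e => hk (e ▸ hl)) hy)
    refine ⟨g * t, Γ.mul_mem hg ht, fun l hl x hx => ?_, fun y hy => ?_⟩
    · simp only [Homeomorph.mul_apply]
      rcases Finset.mem_insert.1 hl with rfl | hl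
      · rw [htk _ (ha l x hx), htk _ (hb l x hx), htk _ (hc l x hx)]
        exact ⟨hgt.map_fst x hx, hgt.map_snd x hx, hgt.map_trd x hx⟩
      · obtain ⟨e1, e2, e3⟩ := h1 l hl x hx
        rw [e1, e2, e3]
        exact ⟨hgl l hl _ (hb l x hx), hgl l hl _ (hc l x hx), hgl l hl _ (ha l x hx)⟩
    · rw [Homeomorph.mul_apply, h2 y fun l hl => hy l (Finset.mem_insert_of_mem hl),
        hgt.apply_of_notMem (hy k (Finset.mem_insert_self k s))]

/-- Finitely many three-cycles with disjoint supports have a product of order dividing three. -/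
lemma exists_pow_three_eq_one {κ : Type*} [Fintype κ] {Γ : Subgroup (X ≃ₜ X)} {D : κ → Set X}
    {a b c : κ → X → X} (h : ∀ k, HasTricycle Γ (D k) (a k) (b k) (c k))
    (hd : ∀ k l, k ≠ l → Disjoint (tricycleSupport (D k) (a k) (b k) (c k))
      (tricycleSupport (D l) (a l) (b l) (c l))) :
    ∃ t ∈ Γ, t ^ 3 = 1 ∧
      (∀ k, ∀ x ∈ D k, t (a k x) = b k x ∧ t (b k x) = c k x ∧ t (c k x) = a k x) ∧
      ∀ y, (∀ k, y ∉ tricycleSupport (D k) (a k) (b k) (c k)) → t y = y := by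
  obtain ⟨t, ht, h1, h2⟩ := exists_mem_forall_apply_eq Finset.univ (fun k _ => h k) hd
  simp only [Finset.mem_univ, true_implies] at h1 h2
  refine ⟨t, ht, ?_, h1, h2⟩
  ext1 y
  simp only [pow_succ, pow_zero, one_mul, Homeomorph.mul_apply, Homeomorph.one_apply]
  by_cases hy : ∀ k, y ∉ tricycleSupport (D k) (a k) (b k) (c k)
  · rw [h2 y hy, h2 y hy, h2 y hy]
  · push Not at hy
    obtain ⟨k, ((⟨x, hx, rfl⟩ | ⟨x, hx, rfl⟩) | ⟨x, hx, rfl⟩)⟩ := hy <;>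
    · obtain ⟨e1, e2, e3⟩ := h1 k x hx
      simp only [e1, e2, e3]

end Families

/-! ### Permutations of copies in a group of homeomorphisms -/

section PermutationSubgroup

variable {X ι : Type*} [TopologicalSpace X]

/-- The permutations of the copies `e i '' univ` of `X` that are induced by elements of `Γ`. -/
def inducedPerm (Γ : Subgroup (X ≃ₜ X)) (e : ι → X → X) : Subgroup (Equiv.Perm ι) where
  carrier := {σ | ∃ g ∈ Γ, PermutesCopies e g σ}
  one_mem' := ⟨1, Γ.one_mem, .one e⟩
  mul_mem' := fun ⟨g, hg, h1⟩ ⟨h, hh, h2⟩ => ⟨g * h, Γ.mul_mem hg hh, h1.mul h2⟩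
  inv_mem' := fun ⟨g, hg, h1⟩ => ⟨g⁻¹, Γ.inv_mem hg, h1.inv⟩

lemma alternatingGroup_le_inducedPerm [Fintype ι] [DecidableEq ι] {Γ : Subgroup (X ≃ₜ X)}
    {e : ι → X → X} (he : Function.Injective (Function.uncurry e))
    (h : ∀ i j k, i ≠ j → i ≠ k → j ≠ k → HasTricycle Γ univ (e i) (e j) (e k)) :
    _root_.alternatingGroup ι ≤ inducedPerm Γ e := by
  rw [← Equiv.Perm.closure_three_cycles_eq_alternating, Subgroup.closure_le]
  intro σ hσ
  obtain ⟨i, hi⟩ := Finset.card_pos.1 (show 0 < σ.support.card by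
    rw [Equiv.Perm.IsThreeCycle.card_support hσ]; norm_num)
  have hform := (Equiv.Perm.IsThreeCycle.eq_swap_mul_swap_iff_mem_support hσ).2 hi
  have hnd := (Equiv.Perm.IsThreeCycle.nodup_iff_mem_support hσ).2 hi
  simp only [List.nodup_cons, List.mem_cons, List.not_mem_nil, or_false, not_or,
    not_false_eq_true, List.nodup_nil, and_true] at hnd
  obtain ⟨g, hg, ht⟩ := h (σ i) (σ (σ i)) i hnd.2 (Ne.symm hnd.1.1) (Ne.symm hnd.1.2)
  refine ⟨g, hg, ?_⟩
  rw [hform, Equiv.swap_comm i (σ i)]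
  exact ht.permutesCopies he hnd.2 (Ne.symm hnd.1.1) (Ne.symm hnd.1.2)

end PermutationSubgroup

/-! ### Recovering the alternating group from realized bisections -/

section Realization

variable {G : Type*} [TopologicalSpace G] [TopologicalGroupoid G] {ι : Type*} [Fintype ι]
  [DecidableEq ι] {e : ι → unitSpace G → unitSpace G}
  {H : Subgroup (unitSpace G ≃ₜ unitSpace G)}

/-- The action `s(b) ↦ r(b)` of a set of arrows is a well defined partial map that is realized
in `H`. -/
def RealizedBisection (H : Subgroup (unitSpace G ≃ₜ unitSpace G))
    (e : ι → unitSpace G → unitSpace G) (C : Set G) : Prop :=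
  ∃ f, (∀ b ∈ C, f (src b) = rng b) ∧ Realized H e (src '' C) f

lemma RealizedBisection.setInv (hH : ContainsAlternating H e) {C : Set G}
    (hC : RealizedBisection H e C) : RealizedBisection H e (setInv C) := by
  obtain ⟨f, hf, hr⟩ := hC
  obtain ⟨g, hg, hr'⟩ := hH.exists_realized_leftInvOn hr
  have hs : src '' TopologicalGroupoid.setInv C = f '' (src '' C) := by
    rw [TopologicalGroupoid.setInv, image_image, image_image]
    exact image_congr fun b hb => by rw [src_inv, hf b hb]
  refine ⟨g, ?_, hs ▸ hr'⟩
  rintro _ ⟨b, hb, rfl⟩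
  simp only
  rw [src_inv, rng_inv, ← hf b hb, hg (mem_image_of_mem _ hb)]

lemma RealizedBisection.setMul (hH : ContainsAlternating H e) {A B : Set G}
    (hA : RealizedBisection H e A) (hB : RealizedBisection H e B) :
    RealizedBisection H e (setMul A B) := by
  obtain ⟨f, hf, hr⟩ := hA
  obtain ⟨g, hg, hr'⟩ := hB
  have hs : src '' TopologicalGroupoid.setMul A B = src '' B ∩ g ⁻¹' (src '' A) := by
    ext x
    constructor
    · rintro ⟨_, ⟨a, ha, b, hb, hab, rfl⟩, rfl⟩
      rw [src_mul hab]
      refine ⟨mem_image_of_mem _ hb, ?_⟩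
      rw [mem_preimage, hg b hb, ← Composable.src_eq_rng hab]
      exact mem_image_of_mem _ ha
    · rintro ⟨⟨b, hb, rfl⟩, ⟨a, ha, hab⟩⟩
      rw [hg b hb] at hab
      have hc := composable_of_src_eq_rng hab
      exact ⟨a * b, ⟨a, ha, b, hb, hc, rfl⟩, src_mul hc⟩
  refine ⟨f ∘ g, ?_, hs ▸ hH.realized_comp hr' hr⟩
  rintro _ ⟨a, ha, b, hb, hab, rfl⟩
  rw [src_mul hab, rng_mul hab, Function.comp, hg b hb, ← Composable.src_eq_rng hab, hf a ha]

lemma realizedBisection_of_mem_familyPow (hH : ContainsAlternating H e) {𝓑 : Set (Set G)}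
    (h𝓑 : ∀ B ∈ 𝓑, RealizedBisection H e B) (m : ℕ) :
    ∀ C ∈ familyPow (𝓑 ∪ setInv '' 𝓑) m, RealizedBisection H e C := by
  have h0 : ∀ C ∈ 𝓑 ∪ setInv '' 𝓑, RealizedBisection H e C := by
    rintro C (hC | ⟨B, hB, rfl⟩)
    · exact h𝓑 C hC
    · exact (h𝓑 B hB).setInv hH
  induction m with
  | zero => exact h0
  | succ m ih =>
    rintro _ ⟨A, hA, B, hB, rfl⟩
    exact (h0 A hA).setMul hH (ih B hB)

variable [CompactSpace (unitSpace G)] [T2Space (unitSpace G)]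

/-- If all the members of a basis of the topology are realized, so are all compact open
bisections. -/
lemma IsLocal.realized (hample : IsAmple G) (hH : ContainsAlternating H e) {𝓒 : Set (Set G)}
    (h𝓒 : TopologicalSpace.IsTopologicalBasis 𝓒) (hr : ∀ C ∈ 𝓒, RealizedBisection H e C)
    {D : Set (unitSpace G)} {f : unitSpace G → unitSpace G} (hf : IsLocal D f) :
    Realized H e D f := by
  obtain ⟨B, hB, rfl, -, hact⟩ := hf.exists_bisection hample
  have hcov : B ⊆ ⋃ C : {C : Set G // C ∈ 𝓒 ∧ C ⊆ B}, C.1 := by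
    intro b hb
    obtain ⟨C, hC, hbC, hCB⟩ := h𝓒.exists_subset_of_mem_open hb hB.2.1
    exact mem_iUnion.2 ⟨⟨C, hC, hCB⟩, hbC⟩
  obtain ⟨s, hs⟩ := hB.1.elim_finite_subcover _ (fun C => h𝓒.isOpen C.2.1) hcov
  have hU : src '' B = ⋃ C ∈ s, src '' C.1 := by
    have : B = ⋃ C ∈ s, C.1 := subset_antisymm hs (iUnion₂_subset fun C _ => C.2.2)
    conv_lhs => rw [this]
    exact image_iUnion₂ _ _
  rw [hU]
  refine hH.realized_biUnion (fun C hC => ?_) (hU ▸ hf.injOn)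
  obtain ⟨f', hf', hr'⟩ := hr C.1 C.2.1
  refine hr'.congr ?_
  rintro _ ⟨b, hb, rfl⟩
  rw [hf' b hb, hact b (C.2.2 hb)]

/-- The members of the partition of the unit space into the copies and the remaining part `Z`. -/
def copyPiece (e : ι → unitSpace G → unitSpace G) (Z : Set (unitSpace G)) :
    Option ι → Set (unitSpace G)
  | none => Z
  | some i => range (e i)

/-- If all partial maps given by the arrows are realized in `H`, and moreover a three-cycle in `H`
connects the remaining part `Z` to two copies, then `H` contains the alternating group. -/
lemma alternatingGroup_le (hample : IsAmple G) (hH : ContainsAlternating H e)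
    (he : ∀ i, IsLocal univ (e i))
    (hr : ∀ (D : Set (unitSpace G)) (f : unitSpace G → unitSpace G), IsLocal D f →
      Realized H e D f)
    {p₀ q₀ : ι} (hpq₀ : p₀ ≠ q₀)
    (hZ : HasTricycle H (⋃ i, range (e i))ᶜ id (e p₀) (e q₀)) :
    alternatingGroup G ≤ H := by
  classical
  set Z := (⋃ i, range (e i))ᶜ with hZdef
  have hZe : ∀ z ∈ Z, ∀ i y, z ≠ e i y := by
    rintro _ hz i y rfl
    exact hz (mem_iUnion.2 ⟨i, y, rfl⟩)
  have hrange : ∀ i, IsClopen (range (e i)) := fun i => by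
    rw [← image_univ]; exact (he i).isClopen_image hample
  have hpiece : ∀ o, IsClopen (copyPiece e Z o) := by
    rintro (_ | i)
    · exact (isClopen_iUnion_of_finite hrange).compl
    · exact hrange i
  have hcover : ∀ y, ∃ o, y ∈ copyPiece e Z o := by
    intro y
    by_cases hy : y ∈ ⋃ i, range (e i)
    · obtain ⟨i, hi⟩ := mem_iUnion.1 hy
      exact ⟨some i, hi⟩
    · exact ⟨none, hy⟩
  have hne : ∀ {o : Option ι} {p : ι}, some p ≠ o → ∀ x ∈ copyPiece e Z o, ∀ y, x ≠ e p y := by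
    rintro (_ | i) p hp x hx y
    · exact hZe x hx p y
    · obtain ⟨x, rfl⟩ := hx
      exact fun h => hp (by rw [(hH.apply_eq_iff.1 h).1])
  have hdisj : ∀ {o o' : Option ι} {x}, x ∈ copyPiece e Z o → x ∈ copyPiece e Z o' → o = o' := by
    rintro o (_ | p) x hx hx'
    · rcases o with _ | i
      · rfl
      · obtain ⟨y, rfl⟩ := hx
        exact absurd rfl (hZe _ hx' i y)
    · by_contra h
      obtain ⟨y, rfl⟩ := hx'
      exact hne (Ne.symm h) _ hx y rfl
  -- a three-cycle of a single map into one of the pieces, together with the inclusions of two other copies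
  have hsingle : ∀ {D : Set (unitSpace G)} {f : unitSpace G → unitSpace G} {o : Option ι}
      {p q : ι}, IsLocal D f → MapsTo f D (copyPiece e Z o) → p ≠ q → some p ≠ o → some q ≠ o →
      HasTricycle H D f (e p) (e q) := by
    rintro D f (_ | i) p q hf hm hpq hp hq
    · exact hH.hasTricycle_of_mapsTo_rest hZe hpq₀ hZ hm (hr D f hf) hpq
    · obtain ⟨g, hg, hgl⟩ := (he i).exists_leftInvOn hample
      rw [image_univ] at hgl
      refine (hH.hasTricycle_of_mapsTo_copy (hr D (g ∘ f) (hf.comp hgl hm))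
        (fun h => hp (congrArg some h.symm)) (fun h => hq (congrArg some h.symm)) hpq).congr
        (fun x hx => ?_)
        (fun _ _ => rfl) fun _ _ => rfl
      obtain ⟨y, hy⟩ := hm hx
      simp only [Function.comp]
      rw [← hy, hg trivial]
  rw [alternatingGroup, Subgroup.closure_le]
  rintro g ⟨hg, hg3, Y, hY, hYd, hYg, hYf⟩
  have hg3' : ∀ y, g (g (g y)) = y := fun y => by
    have h := pow_orderOf_eq_one g
    rw [hg3] at h
    have h' := DFunLike.congr_fun h y
    simpa only [pow_succ, pow_zero, one_mul, Homeomorph.mul_apply, Homeomorph.one_apply] using h'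
  have hg01 : ∀ y ∈ Y 0, g y ∈ Y 1 := fun y hy => (hYg 0) ▸ mem_image_of_mem g hy
  have hg12 : ∀ y ∈ Y 1, g y ∈ Y 2 := fun y hy => (hYg 1) ▸ mem_image_of_mem g hy
  have hgl : IsLocal univ g := isLocal_of_mem_topologicalFullGroup hg
  have hY0 : IsClopen (Y 0) := ⟨(hY 0).1.isClosed, (hY 0).2⟩
  have hsep : Separated (Y 0) id g (g ∘ g) := by
    refine ⟨injOn_id _, g.injective.injOn, (g.injective.comp g.injective).injOn, ?_, ?_, ?_⟩
    · exact fun x hx y hy h => disjoint_left.1 (hYd 0 1 (by decide)) hx (by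
        rw [show x = g y from h]; exact hg01 y hy)
    · exact fun x hx y hy h => disjoint_left.1 (hYd 1 2 (by decide)) (hg01 x hx) (by
        rw [h]; exact hg12 _ (hg01 y hy))
    · exact fun x hx y hy h => disjoint_left.1 (hYd 2 0 (by decide)) (hg12 _ (hg01 x hx)) (by
        rw [show g (g x) = y from h]; exact hy)
  have hgt : IsTricycle g (Y 0) id g (g ∘ g) := by
    refine ⟨fun _ _ => rfl, fun _ _ => rfl, fun x _ => hg3' x, fun y hy => hYf y ?_⟩
    rw [mem_iUnion, not_exists]
    have h0 : y ∉ Y 0 := fun h => (hy y h).1 rfl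
    have h1 : y ∉ Y 1 := fun h => by
      rw [show (1 : Fin 3) = 0 + 1 from rfl, ← hYg 0] at h
      obtain ⟨x, hx, rfl⟩ := h
      exact (hy x hx).2.1 rfl
    have h2 : y ∉ Y 2 := fun h => by
      rw [show (2 : Fin 3) = 1 + 1 from rfl, ← hYg 1, show (1 : Fin 3) = 0 + 1 from rfl,
        ← hYg 0] at h
      obtain ⟨_, ⟨x, hx, rfl⟩, rfl⟩ := h
      exact (hy x hx).2.2 rfl
    intro j
    fin_cases j
    · exact h0
    · exact h1
    · exact h2
  suffices h : HasTricycle H (Y 0) id g (g ∘ g) by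
    obtain ⟨h, hh, hht⟩ := h
    rwa [hgt.unique hht]
  let P : Option ι × Option ι × Option ι → Set (unitSpace G) := fun o =>
    Y 0 ∩ (copyPiece e Z o.1 ∩ (g ⁻¹' copyPiece e Z o.2.1 ∩ (g ∘ g) ⁻¹' copyPiece e Z o.2.2))
  have hPU : Y 0 = ⋃ o ∈ (Finset.univ : Finset (Option ι × Option ι × Option ι)), P o := by
    refine subset_antisymm (fun x hx => ?_) (iUnion₂_subset fun o _ => inter_subset_left)
    obtain ⟨o1, h1⟩ := hcover x
    obtain ⟨o2, h2⟩ := hcover (g x)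
    obtain ⟨o3, h3⟩ := hcover (g (g x))
    exact mem_iUnion₂.2 ⟨(o1, o2, o3), Finset.mem_univ _, hx, h1, h2, h3⟩
  rw [hPU] at hsep ⊢
  refine HasTricycle.biUnion (fun o _ => ?_) (fun o _ o' _ hoo' => ?_) hsep
  · have hPo : IsClopen (P o) := hY0.inter ((hpiece _).inter
      (((hpiece _).preimage g.continuous).inter
        ((hpiece _).preimage (g.continuous.comp g.continuous))))
    have hcard : 1 < (Finset.univ.filter fun i : ι => some i ∉ ({o.1, o.2.1, o.2.2} :
        Finset (Option ι))).card := by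
      have h1 := Finset.card_filter_add_card_filter_not (s := (Finset.univ : Finset ι))
        fun i : ι => some i ∈ ({o.1, o.2.1, o.2.2} : Finset (Option ι))
      have h2 : (Finset.univ.filter fun i : ι => some i ∈ ({o.1, o.2.1, o.2.2} :
          Finset (Option ι))).card ≤ 3 := by
        refine (Finset.card_le_card_of_injOn some (fun i hi => (Finset.mem_filter.1 hi).2)
          (Option.some_injective ι).injOn).trans Finset.card_le_three
      have h3 := hH.card
      rw [Finset.card_univ] at h1
      omega
    obtain ⟨p, hp, q, hq, hpq⟩ := Finset.one_lt_card.1 hcard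
    simp only [Finset.mem_filter, Finset.mem_univ, true_and, Finset.mem_insert,
      Finset.mem_singleton, not_or] at hp hq
    have m1 : MapsTo id (P o) (copyPiece e Z o.1) := fun x hx => hx.2.1
    have m2 : MapsTo g (P o) (copyPiece e Z o.2.1) := fun x hx => hx.2.2.1
    have m3 : MapsTo (g ∘ g) (P o) (copyPiece e Z o.2.2) := fun x hx => hx.2.2.2
    refine HasTricycle.of_common (u := e p) (v := e q) (hsingle (IsLocal.id hPo) m1 hpq hp.1 hq.1)
      (hsingle (hgl.mono hPo (subset_univ _)) m2 hpq hp.2.1 hq.2.1)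
      (hsingle ((hgl.mono hPo (subset_univ _)).comp hgl (mapsTo_univ _ _)) m3 hpq hp.2.2 hq.2.2)
      (hsep.mono (subset_biUnion_of_mem (Finset.mem_coe.2 (Finset.mem_univ o)))) ?_ ?_
    · exact fun x hx y _ => ⟨hne hp.1 _ (m1 hx) y, hne hq.1 _ (m1 hx) y⟩
    · exact fun x hx y _ => ⟨hne hp.2.1 _ (m2 hx) y, hne hq.2.1 _ (m2 hx) y⟩
  · rw [disjoint_left]
    intro x hx hx'
    exact hoo' (Prod.ext (hdisj hx.2.1 hx'.2.1)
      (Prod.ext (hdisj hx.2.2.1 hx'.2.2.1) (hdisj hx.2.2.2 hx'.2.2.2)))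

end Realization

/-! ### Construction of the two generators -/

section Generators

variable {G : Type*} [TopologicalSpace G] [TopologicalGroupoid G] [CompactSpace (unitSpace G)]
  [T2Space (unitSpace G)]

/-- Pure infiniteness provides any finite number of disjoint copies of the unit space in itself. -/
lemma exists_copies_fin (hpi : IsPurelyInfinite G) (N : ℕ) :
    ∃ e : Fin N → unitSpace G → unitSpace G, (∀ i, IsLocal univ (e i)) ∧
      Function.Injective (Function.uncurry e) := by
  obtain ⟨B, B', hB, hB', hs, hs', hd, -, -⟩ := hpi univ isCompact_univ isOpen_univ
  obtain ⟨f, hf⟩ := hB.2.exists_map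
  obtain ⟨f', hf'⟩ := hB'.2.exists_map
  have lf := IsLocal.of_bisection hB hf
  have lf' := IsLocal.of_bisection hB' hf'
  rw [hs] at lf
  rw [hs'] at lf'
  have mf : ∀ x, f x ∈ rng '' B := fun x => by
    obtain ⟨b, hb, rfl⟩ := hs.symm ▸ mem_univ x
    rw [hf b hb]; exact mem_image_of_mem _ hb
  have mf' : ∀ x, f' x ∈ rng '' B' := fun x => by
    obtain ⟨b, hb, rfl⟩ := hs'.symm ▸ mem_univ x
    rw [hf' b hb]; exact mem_image_of_mem _ hb
  have hne : ∀ x y, f x ≠ f' y := fun x y h => disjoint_left.1 hd (mf x) (h ▸ mf' y)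
  induction N with
  | zero => exact ⟨fun i => i.elim0, fun i => i.elim0, fun p => p.1.elim0⟩
  | succ N ih =>
    obtain ⟨e, he, hei⟩ := ih
    refine ⟨Fin.cons f fun i => f' ∘ e i, fun i => ?_, ?_⟩
    · refine Fin.cases lf (fun i => ?_) i
      exact (he i).comp lf' (mapsTo_univ _ _)
    · rintro ⟨i, x⟩ ⟨j, y⟩ h
      simp only [Function.uncurry_apply_pair] at h
      induction i using Fin.cases with
      | zero =>
        induction j using Fin.cases with
        | zero => rw [lf.injOn trivial trivial h]
        | succ j => exact absurd h (hne _ _)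
      | succ i =>
        induction j using Fin.cases with
        | zero => exact absurd h.symm (hne _ _)
        | succ j =>
          have h1 : (i, x) = (j, y) := hei (lf'.injOn trivial trivial h)
          obtain ⟨rfl, rfl⟩ := Prod.ext_iff.1 h1
          rfl

lemma exists_copies (hpi : IsPurelyInfinite G) (ι : Type*) [Fintype ι] :
    ∃ e : ι → unitSpace G → unitSpace G, (∀ i, IsLocal univ (e i)) ∧
      Function.Injective (Function.uncurry e) := by
  obtain ⟨e, he, hei⟩ := exists_copies_fin hpi (Fintype.card ι)
  refine ⟨fun i => e (Fintype.equivFin ι i), fun i => he _, ?_⟩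
  rintro ⟨i, x⟩ ⟨j, y⟩ h
  have h1 := Prod.ext_iff.1 (@hei (Fintype.equivFin ι i, x) (Fintype.equivFin ι j, y) h)
  exact Prod.ext ((Fintype.equivFin ι).injective h1.1) h1.2

/-- A homeomorphism `t` which carries, on disjoint copies of the unit space, a three-cycle along
each of the maps `f k`, and a three-cycle that connects two further copies with the part of the
unit space outside all the copies. It fixes the copies with index `θ (.inr _)`, and commutes with
every permutation of the copies that fixes all the indices in the range of `θ`. -/
lemma exists_simultaneous_tricycles (hample : IsAmple G) {κ ι : Type*} [Fintype κ] [Finite ι]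
    {e : ι → unitSpace G → unitSpace G} (he : ∀ i, IsLocal univ (e i))
    (hei : Function.Injective (Function.uncurry e)) {D : κ → Set (unitSpace G)}
    {f : κ → unitSpace G → unitSpace G} (hf : ∀ k, IsLocal (D k) (f k))
    (θ : (Option κ × Fin 3) ⊕ Fin 8 ↪ ι) :
    ∃ t ∈ alternatingGroup G, t ^ 3 = 1 ∧
      (∀ k, ∀ x ∈ D k, t (e (θ (.inl (some k, 0))) x) = e (θ (.inl (some k, 1))) (f k x) ∧
        t (e (θ (.inl (some k, 2))) (f k x)) = e (θ (.inl (some k, 0))) x) ∧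
      (∀ k, ∀ x ∉ D k, t (e (θ (.inl (some k, 0))) x) = e (θ (.inl (some k, 0))) x) ∧
      (∀ x ∈ (⋃ i, range (e i))ᶜ, t x = e (θ (.inl (none, 1))) x ∧
        t (e (θ (.inl (none, 1))) x) = e (θ (.inl (none, 2))) x) ∧
      (∀ x ∉ (⋃ i, range (e i))ᶜ, t (e (θ (.inl (none, 1))) x) = e (θ (.inl (none, 1))) x) ∧
      (∀ r x, t (e (θ (.inr r)) x) = e (θ (.inr r)) x) ∧
      ∀ ρ : unitSpace G ≃ₜ unitSpace G, (∀ z x, ρ (e (θ z) x) = e (θ z) x) →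
        (∀ y, (∀ i x, y ≠ e i x) → ρ y = y) → Commute ρ t := by
  set Z := (⋃ i, range (e i))ᶜ with hZdef
  have hZe : ∀ z ∈ Z, ∀ i y, z ≠ e i y := by
    rintro _ hz i y rfl
    exact hz (mem_iUnion.2 ⟨i, y, rfl⟩)
  have hrange : ∀ i, IsClopen (range (e i)) := fun i => by
    rw [← image_univ]; exact (he i).isClopen_image hample
  have hZc : IsClopen Z := (isClopen_iUnion_of_finite hrange).compl
  have hE : ∀ {z w x y}, e (θ z) x = e (θ w) y ↔ z = w ∧ x = y := by
    intro z w x y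
    refine ⟨fun h => ?_, fun h => by rw [h.1, h.2]⟩
    have h1 := Prod.ext_iff.1 (@hei (θ z, x) (θ w, y) h)
    exact ⟨θ.injective h1.1, h1.2⟩
  -- the domains and maps of the three-cycles; the index `none` stands for the one through `Z`
  let D' : Option κ → Set (unitSpace G) := fun o => o.elim Z D
  let f' : Option κ → unitSpace G → unitSpace G := fun o => o.elim id f
  let a : Option κ → unitSpace G → unitSpace G := fun o =>
    o.elim id fun k => e (θ (.inl (some k, 0)))
  let b : Option κ → unitSpace G → unitSpace G := fun o => e (θ (.inl (o, 1))) ∘ f' o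
  let c : Option κ → unitSpace G → unitSpace G := fun o => e (θ (.inl (o, 2))) ∘ f' o
  have hf' : ∀ o, IsLocal (D' o) (f' o) := by
    rintro (_ | k)
    · exact IsLocal.id hZc
    · exact hf k
  have ha : ∀ o, IsLocal (D' o) (a o) := by
    rintro (_ | k)
    · exact IsLocal.id hZc
    · exact (he _).mono (hf k).isClopen (subset_univ _)
  have hab : ∀ o o', ∀ x ∈ D' o, ∀ (s : Fin 3) y, s ≠ 0 → a o x ≠ e (θ (.inl (o', s))) y := by
    rintro (_ | k) o' x hx s y hs
    · exact hZe x hx _ _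
    · change e _ x ≠ _
      rw [Ne, hE]
      rintro ⟨h, -⟩
      simp only [Sum.inl.injEq, Prod.mk.injEq] at h
      exact hs h.2.symm
  have hT : ∀ o, HasTricycle (alternatingGroup G) (D' o) (a o) (b o) (c o) := by
    refine fun o => hasTricycle_alternatingGroup hample (ha o)
      ((hf' o).comp (he _) (mapsTo_univ _ _))
      ((hf' o).comp (he _) (mapsTo_univ _ _)) ⟨(ha o).injOn,
        ((he _).injOn.comp (hf' o).injOn (mapsTo_univ _ _)),
        ((he _).injOn.comp (hf' o).injOn (mapsTo_univ _ _)),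
        fun x hx y _ => hab o o x hx 1 _ (by decide), fun x _ y _ => ?_,
        fun x _ y hy => (hab o o y hy 2 _ (by decide)).symm⟩
    simp [b, c, hE]
  have hd : ∀ o o', o ≠ o' → Disjoint (tricycleSupport (D' o) (a o) (b o) (c o))
      (tricycleSupport (D' o') (a o') (b o') (c o')) := by
    have haa : ∀ o o', o ≠ o' → ∀ x ∈ D' o, ∀ y ∈ D' o', a o x ≠ a o' y := by
      rintro (_ | k) (_ | l) h x hx y hy
      · exact absurd rfl h
      · exact hZe x hx _ _
      · exact (hZe y hy _ _).symm
      · simp only [a, Option.elim_some, Ne, hE, Sum.inl.injEq, Prod.mk.injEq]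
        exact fun h' => h h'.1.1
    intro o o' h
    rw [disjoint_left]
    rintro _ ((⟨x, hx, rfl⟩ | ⟨x, hx, rfl⟩) | ⟨x, hx, rfl⟩)
      ((⟨y, hy, hxy⟩ | ⟨y, hy, hxy⟩) | ⟨y, hy, hxy⟩)
    · exact haa o o' h x hx y hy hxy.symm
    · exact hab o o' x hx 1 _ (by decide) hxy.symm
    · exact hab o o' x hx 2 _ (by decide) hxy.symm
    · exact hab o' o y hy 1 _ (by decide) hxy
    · simp [b, hE, h.symm] at hxy
    · simp [b, c, hE] at hxy
    · exact hab o' o y hy 2 _ (by decide) hxy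
    · simp [b, c, hE] at hxy
    · simp [c, hE, h.symm] at hxy
  obtain ⟨t, ht, ht3, hta, htf⟩ := exists_pow_three_eq_one hT hd
  refine ⟨t, ht, ht3, fun k x hx => ⟨(hta (some k) x hx).1, (hta (some k) x hx).2.2⟩,
    fun k x hx => htf _ ?_, fun x hx => ⟨(hta none x hx).1, (hta none x hx).2.1⟩,
    fun x hx => htf _ ?_, fun r x => htf _ ?_, fun ρ h1 h2 => ?_⟩
  · rintro o ((⟨y, hy, h⟩ | ⟨y, hy, h⟩) | ⟨y, hy, h⟩)
    · rcases o with _ | l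
      · exact hZe y hy _ _ h
      · simp only [a, Option.elim_some, hE, Sum.inl.injEq, Prod.mk.injEq, Option.some.injEq] at h
        obtain ⟨⟨rfl, -⟩, rfl⟩ := h
        exact hx hy
    · simp [b, hE] at h
    · simp [c, hE] at h
  · rintro o ((⟨y, hy, h⟩ | ⟨y, hy, h⟩) | ⟨y, hy, h⟩)
    · exact hab o none y hy 1 x (by decide) h
    · simp only [b, Function.comp, hE, Sum.inl.injEq, Prod.mk.injEq, and_true] at h
      obtain ⟨rfl, rfl⟩ := h
      exact hx hy
    · simp [c, hE] at h
  · rintro o ((⟨y, hy, h⟩ | ⟨y, hy, h⟩) | ⟨y, hy, h⟩)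
    · rcases o with _ | l
      · exact hZe y hy _ _ h
      · simp [a, hE] at h
    · simp [b, hE] at h
    · simp [c, hE] at h
  · have hρ : ∀ o, ∀ y ∈ tricycleSupport (D' o) (a o) (b o) (c o), ρ y = y := by
      rintro o _ ((⟨y, hy, rfl⟩ | ⟨y, hy, rfl⟩) | ⟨y, hy, rfl⟩)
      · rcases o with _ | l
        · exact h2 _ (hZe y hy)
        · exact h1 _ _
      · exact h1 _ _
      · exact h1 _ _
    ext1 y
    rw [Homeomorph.mul_apply, Homeomorph.mul_apply]
    by_cases hy : ∀ o, y ∉ tricycleSupport (D' o) (a o) (b o) (c o)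
    · rw [htf y hy, htf (ρ y)]
      intro o ho
      have := ρ.injective (hρ o _ ho)
      exact hy o (this ▸ ho)
    · push Not at hy
      obtain ⟨o, ho⟩ := hy
      rw [hρ o y ho]
      obtain ((⟨x, hx, rfl⟩ | ⟨x, hx, rfl⟩) | ⟨x, hx, rfl⟩) := ho
      · rw [(hta o x hx).1]
        exact hρ o _ (Or.inl (Or.inr (mem_image_of_mem _ hx)))
      · rw [(hta o x hx).2.1]
        exact hρ o _ (Or.inr (mem_image_of_mem _ hx))
      · rw [(hta o x hx).2.2]
        exact hρ o _ (Or.inl (Or.inl (mem_image_of_mem _ hx)))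

/-- Two generators of the alternating group, for an expansive, ample and purely infinite groupoid
with compact unit space. -/
lemma exists_generators_of_isPurelyInfinite [Nonempty (unitSpace G)] (hexp : IsExpansive G)
    (hample : IsAmple G) (hpi : IsPurelyInfinite G) {n : ℕ} (hn : 2 < n) :
    ∃ g₁ ∈ alternatingGroup G, ∃ g₂ ∈ alternatingGroup G,
      orderOf g₁ = n ∧ IsOfFinOrder g₂ ∧ Subgroup.closure {g₁, g₂} = alternatingGroup G := by
  obtain ⟨-, -, -, 𝓑, ⟨hfin, hbis, hbasis⟩, -⟩ := hexp
  have : Fintype 𝓑 := hfin.fintype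
  obtain ⟨ι, _, _, π, ρ, F, k, hF, hρF, hπn, hπA, hρA, hρk, hgen⟩ :=
    exists_generators_alternatingGroup hn (Fintype.card ((Option 𝓑 × Fin 3) ⊕ Fin 8))
  obtain ⟨θ₀⟩ := Function.Embedding.nonempty_of_card_le (α := (Option 𝓑 × Fin 3) ⊕ Fin 8) (β := F)
    (by rwa [Fintype.card_coe])
  let θ : (Option 𝓑 × Fin 3) ⊕ Fin 8 ↪ ι := θ₀.trans (Function.Embedding.subtype _)
  have hθ : ∀ z, ρ (θ z) = θ z := fun z => hρF _ (θ₀ z).2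
  obtain ⟨e, he, hei⟩ := exists_copies hpi ι
  choose f hf using fun B : 𝓑 => (hbis B.1 B.2).2.exists_map
  have hfl : ∀ B, IsLocal (src '' B.1) (f B) := fun B => .of_bisection (hbis B.1 B.2) (hf B)
  obtain ⟨t, htA, ht3, ht1, ht2, ht4, ht5, ht6, htc⟩ :=
    exists_simultaneous_tricycles hample he hei hfl θ
  have hAlt : _root_.alternatingGroup ι ≤ inducedPerm (alternatingGroup G) e := by
    refine alternatingGroup_le_inducedPerm hei fun i j k hij hik hjk => ?_
    exact hasTricycle_alternatingGroup hample (he i) (he j) (he k)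
      (separated_copies (f := id) hei (injOn_id _) hij hik hjk)
  obtain ⟨g₁, hg₁, hπg⟩ := hAlt hπA
  obtain ⟨r, hr, hρr⟩ := hAlt hρA
  -- the commuting elements `r` and `t` have coprime orders, so both are powers of `r * t`
  have hcomm : Commute r t := htc r (fun z x => by rw [hρr.map, hθ]) hρr.fix
  have hrk : r ^ (3 * k + 1) = 1 := by
    have h := hρr.pow (3 * k + 1)
    rw [hρk] at h
    exact h.unique (.one e)
  have htk : t ^ (3 * k + 1) = t := by rw [pow_succ, pow_mul, ht3, one_pow, one_mul]
  have hpow : (r * t) ^ (3 * k + 1) = t := by rw [hcomm.mul_pow, hrk, htk, one_mul]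
  refine ⟨g₁, hg₁, r * t, mul_mem hr htA, by rw [hπg.orderOf_eq hei, hπn],
    isOfFinOrder_iff_pow_eq_one.2 ⟨(3 * k + 1) * 3, by omega, by rw [pow_mul, hpow, ht3]⟩,
    le_antisymm ?_ ?_⟩
  · rw [Subgroup.closure_le]
    rintro g (rfl | rfl)
    · exact hg₁
    · exact mul_mem hr htA
  set H := Subgroup.closure {g₁, r * t} with hHdef
  have hg₁H : g₁ ∈ H := Subgroup.subset_closure (by simp)
  have hrtH : r * t ∈ H := Subgroup.subset_closure (by simp)
  have htH : t ∈ H := hpow ▸ H.pow_mem hrtH _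
  have hrH : r ∈ H := (Subgroup.mul_mem_cancel_right H htH).1 hrtH
  have hH : ContainsAlternating H e := by
    refine ⟨hei, ?_, ?_⟩
    · have := Fintype.card_le_of_embedding θ
      rw [Fintype.card_sum, Fintype.card_fin] at this
      omega
    · have : Subgroup.closure {π, ρ} ≤ inducedPerm H e := by
        rw [Subgroup.closure_le]
        rintro σ (rfl | rfl)
        · exact ⟨g₁, hg₁H, hπg⟩
        · exact ⟨r, hrH, hρr⟩
      exact fun σ hσ => this (hgen hσ)
  have hne : ∀ {z w}, z ≠ w → θ z ≠ θ w := fun h => θ.injective.ne h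
  have hreal : ∀ B ∈ 𝓑, RealizedBisection H e B := fun B hB => by
    refine ⟨f ⟨B, hB⟩, hf ⟨B, hB⟩, ?_⟩
    exact hH.realized_of_apply (i := θ (.inl (some ⟨B, hB⟩, 0))) (j := θ (.inl (some ⟨B, hB⟩, 1)))
      (k := θ (.inl (some ⟨B, hB⟩, 2))) (p := θ (.inr 0)) (q := θ (.inr 1)) htH
      (hfl ⟨B, hB⟩).injOn (hne (by simp)) (hne (by simp)) (hne (by simp)) (hne (by simp))
      (hne (by simp)) (hne (by simp)) (hne (by simp)) (hne (by simp)) (hne (by simp))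
      (hne (by simp)) (fun x hx => (ht1 _ x hx).1) (fun x hx => (ht1 _ x hx).2) (ht2 ⟨B, hB⟩)
      (ht6 0) (ht6 1)
  have hbasis' : ∀ C ∈ ⋃ m : ℕ, familyPow (𝓑 ∪ setInv '' 𝓑) m, RealizedBisection H e C := by
    intro C hC
    obtain ⟨m, hm⟩ := mem_iUnion.1 hC
    exact realizedBisection_of_mem_familyPow hH hreal m C hm
  refine alternatingGroup_le hample hH he (fun D f hf => hf.realized hample hH hbasis hbasis')
    (p₀ := θ (.inr 0)) (q₀ := θ (.inl (none, 1))) (hne (by simp)) ?_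
  refine hH.hasTricycle_of_apply (j := θ (.inl (none, 2))) (q := θ (.inr 1)) htH ?_
    (hne (by simp)) (hne (by simp)) (hne (by simp)) (hne (by simp)) (hne (by simp))
    (hne (by simp)) (fun x hx => (ht4 x hx).1) (fun x hx => (ht4 x hx).2) ht5 (ht6 0) (ht6 1)
  rintro _ hz i y rfl
  exact hz (mem_iUnion.2 ⟨i, y, rfl⟩)

end Generators

end TopologicalGroupoid

theorem mainTheorem3 (G : Type*) [TopologicalSpace G] [T2Space G] [TopologicalGroupoid G]
    (hcantor : TopologicalGroupoid.IsCantor G)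
    (hexp : TopologicalGroupoid.IsExpansive G)
    (hample : TopologicalGroupoid.IsAmple G)
    (hprin : TopologicalGroupoid.IsEssentiallyPrincipal G)
    (hmin : TopologicalGroupoid.IsMinimal G)
    (hpi : TopologicalGroupoid.IsPurelyInfinite G)
    (n : ℕ) (hn : 2 < n) :
    ∃ g₁ ∈ TopologicalGroupoid.alternatingGroup G,
      ∃ g₂ ∈ TopologicalGroupoid.alternatingGroup G,
        orderOf g₁ = n ∧ IsOfFinOrder g₂ ∧
          Subgroup.closure {g₁, g₂} = TopologicalGroupoid.alternatingGroup G := by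
  obtain ⟨φ⟩ := hcantor
  have : CompactSpace (TopologicalGroupoid.unitSpace G) := φ.symm.compactSpace
  have : Nonempty (TopologicalGroupoid.unitSpace G) := ⟨φ.symm fun _ => true⟩
  exact TopologicalGroupoid.exists_generators_of_isPurelyInfinite hexp hample hpi hn
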